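/- Let $T,A,A^m,k,k^m,\sigma,\kappa,\phi,\gamma,\bar\lambda^+,\bar\lambda^->0$ be real numbers and $\tilde q,\tilde q^m,\tilde b\ge 1$ integers. Put $\mathcal Q=\{-\tilde q,\dots,\tilde q\}$, $\mathcal Q^m=\{-\tilde q^m,\dots,\tilde q^m\}$, $\mathcal B=\{-\tilde b,\dots,\tilde b\}$, $$\Lambda(x,y)=A e^{-\frac k\sigma(x+y)},\qquad \Lambda^m(x)=A^m e^{-\frac{k^m}\sigma x},\qquad \bar d(x)=\frac\sigma k+x,\qquad \bar d^m(x)=\frac\sigma{k^m}+x,$$ $$\mathcal L(y,x^b,x^a)=\mathbf 1_{\{y<\tilde q^m\}}\Lambda^m(x^b)-\mathbf 1_{\{y>-\tilde q^m\}}\Lambda^m(x^a).$$ Let $P_0$ be a probability mass function on $\mathcal Q^m\times\mathcal B$. For $W:[0,T]\times\mathcal Q\to\mathbb R$, $W^m,p:[0,T]\times\mathcal Q^m\times\mathcal B\to\mathbb R$, write (omitting $t$) $$\delta^{b}(q)=\bar d\big(W(q)-W(q+1)\big),\qquad \delta^{a}(q)=\bar d\big(W(q)-W(q-1)\big),$$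 $$\delta^{m,b}(y,z)=\bar d^m\big(W^m(y,z)-W^m(y+1,z)\big),\qquad \delta^{m,a}(y,z)=\bar d^m\big(W^m(y,z)-W^m(y-1,z)\big),$$ $$D^i=\sum_{(y,z)\in\mathcal Q^m\times\mathcal B}\delta^{m,i}(y,z)\,p(y,z)\ \ (i\in\{a,b\}),\qquad I=\kappa\sum_{(y,z)\in\mathcal Q^m\times\mathcal B}\mathcal L\big(y,\delta^{m,b}(y,z),\delta^{m,a}(y,z)\big)\,p(y,z).$$ Terms multiplied by a vanishing indicator are $0$, so values off the grids do not matter, except that $D^b$ and $D^a$ contain the quotes $\delta^{m,b}(\tilde q^m,z)$ and $\delta^{m,a}(-\tilde q^m,z)$ on the sides where the risk limit forbids trading. For these, fix any functions $e^\pm:[0,T]\times\mathcal B\times\mathbb R\to\mathbb R$, continuous in the first and third variables jointly, and set $W^m(t,\pm(\tilde q^m+1),z)=e^\pm\big(t,z,W^m(t,\pm\tilde q^m,z)\big)$. The master equation is the following system, for all $t\in[0,T]$ (one-sided derivatives at $0$ and $T$), $q\in\mathcal Q$, $q^m\in\mathcal Q^m$, $b^m\in\mathcal B$. Market-maker's Hamilton–Jacobi–Bellman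 equation: $$0=\partial_tW(q)-\phi\sigma^2q^2+q\,I+\mathbf 1_{\{q<\tilde q\}}\Lambda\big(D^a,\delta^b(q)\big)\big(\delta^b(q)+W(q+1)-W(q)\big)+\mathbf 1_{\{q>-\tilde q\}}\Lambda\big(D^b,\delta^a(q)\big)\big(\delta^a(q)+W(q-1)-W(q)\big).$$ Representative market-taker's Hamilton–Jacobi–Bellman equation: $$\begin{aligned}0=\ &\partial_tW^m(q^m,b^m)-\gamma\sigma^2(q^m)^2+b^mq^m+q^m I\\&+\mathbf 1_{\{b^m<\tilde b\}}\bar\lambda^+\big(W^m(q^m,b^m+1)-W^m(q^m,b^m)\big)+\mathbf 1_{\{b^m>-\tilde b\}}\bar\lambda^-\big(W^m(q^m,b^m-1)-W^m(q^m,b^m)\big)\\&+\mathbf 1_{\{q^m<\tilde q^m\}}\Lambda^m\big(\delta^{m,b}(q^m,b^m)\big)\big(\delta^{m,b}(q^m,b^m)+W^m(q^m+1,b^m)-W^m(q^m,b^m)\big)\\&+\mathbf 1_{\{q^m>-\tilde q^m\}}\Lambda^m\big(\delta^{m,a}(q^m,b^m)\big)\big(\delta^{m,a}(q^m,b^m)+W^m(q^m-1,b^m)-W^m(q^m,b^m)\big).\end{aligned}$$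 Fokker–Planck equation: $$\begin{aligned}0=\ &\partial_tp(q^m,b^m)-\mathbf 1_{\{q^m>-\tilde q^m\}}\Lambda^m\big(\delta^{m,b}(q^m-1,b^m)\big)p(q^m-1,b^m)-\mathbf 1_{\{q^m<\tilde q^m\}}\Lambda^m\big(\delta^{m,a}(q^m+1,b^m)\big)p(q^m+1,b^m)\\&-\bar\lambda^+\mathbf 1_{\{b^m>-\tilde b\}}p(q^m,b^m-1)-\bar\lambda^-\mathbf 1_{\{b^m<\tilde b\}}p(q^m,b^m+1)\\&+\Big(\mathbf 1_{\{q^m<\tilde q^m\}}\Lambda^m\big(\delta^{m,b}(q^m,b^m)\big)+\mathbf 1_{\{q^m>-\tilde q^m\}}\Lambda^m\big(\delta^{m,a}(q^m,b^m)\big)+\bar\lambda^-\mathbf 1_{\{b^m>-\tilde b\}}+\bar\lambda^+\mathbf 1_{\{b^m<\tilde b\}}\Big)p(q^m,b^m).\end{aligned}$$ The conditions are $p(0,\cdot,\cdot)=P_0$, $W(T,\cdot)=0$, $W^m(T,\cdot,\cdot)=0$. **Theorem.** The master equation with these conditions has a solution $(W,W^m,p)$ such that $W$ is $C^1$ in time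 and bounded on $[0,T]\times\mathcal Q$, $W^m$ and $p$ are $C^1$ in time and bounded on $[0,T]\times\mathcal Q^m\times\mathcal B$, and $p(t,\cdot,\cdot)$ is a probability mass function for every $t\in[0,T]$. For every $\delta_\infty>0$ the same holds when quotes are restricted to $[-\delta_\infty,\delta_\infty]$, that is, when $\bar d$ and $\bar d^m$ are replaced throughout by $x\mapsto\max(-\delta_\infty,\min(\delta_\infty,\bar d(x)))$ and $x\mapsto\max(-\delta_\infty,\min(\delta_\infty,\bar d^m(x)))$. -/

import Mathlib

open Set

noncomputable section

/-- The data of the market model: horizon, intensity parameters of the market-maker and of the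
market-takers, volatility, permanent impact, risk aversions, intensities of the signal, and risk
limits (the grids are `{-qMax, …, qMax}`, `{-qmMax, …, qmMax}` and `{-bMax, …, bMax}`).
All of them are positive. -/
structure MarketModel where
  T : ℝ
  A : ℝ
  Am : ℝ
  k : ℝ
  km : ℝ
  σ : ℝ
  κ : ℝ
  φ : ℝ
  γ : ℝ
  lamPlus : ℝ
  lamMinus : ℝ
  qMax : ℤ
  qmMax : ℤ
  bMax : ℤ
  T_pos : 0 < T
  A_pos : 0 < A
  Am_pos : 0 < Am
  k_pos : 0 < k
  km_pos : 0 < km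
  σ_pos : 0 < σ
  κ_pos : 0 < κ
  φ_pos : 0 < φ
  γ_pos : 0 < γ
  lamPlus_pos : 0 < lamPlus
  lamMinus_pos : 0 < lamMinus
  qMax_pos : 0 < qMax
  qmMax_pos : 0 < qmMax
  bMax_pos : 0 < bMax

namespace MarketModel

/-- Inventories of the market-maker. -/
def gridQ (M : MarketModel) : Finset ℤ := Finset.Icc (-M.qMax) M.qMax

/-- Inventories of the market-takers. -/
def gridQm (M : MarketModel) : Finset ℤ := Finset.Icc (-M.qmMax) M.qmMax

/-- Signals of the market-takers. -/
def gridB (M : MarketModel) : Finset ℤ := Finset.Icc (-M.bMax) M.bMax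

/-- Intensity function of the market-maker, `A exp (-(k/σ) (x + y))`. -/
def Lam (M : MarketModel) (x y : ℝ) : ℝ := M.A * Real.exp (-(M.k / M.σ) * (x + y))

/-- Intensity function of the market-takers, `Aᵐ exp (-(kᵐ/σ) x)`. -/
def Lamm (M : MarketModel) (x : ℝ) : ℝ := M.Am * Real.exp (-(M.km / M.σ) * x)

/-- `π (y, z)`, for `y` an inventory and `z` a signal, is a probability mass function on the
grid of the market-takers (its values off the grid are irrelevant). -/
def IsPMF (M : MarketModel) (π : ℤ → ℤ → ℝ) : Prop :=
  (∀ y ∈ M.gridQm, ∀ z ∈ M.gridB, 0 ≤ π y z) ∧ ∑ y ∈ M.gridQm, ∑ z ∈ M.gridB, π y z = 1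

/-- Integral of `f (y, z)` against the mass function `π`. -/
def integ (M : MarketModel) (f π : ℤ → ℤ → ℝ) : ℝ :=
  ∑ y ∈ M.gridQm, ∑ z ∈ M.gridB, f y z * π y z

/-- Net rate of the trades of a market-taker with inventory `y` and quotes `xb`, `xa`
(bid trades raise the inventory, ask trades lower it). -/
def netRate (M : MarketModel) (y : ℤ) (xb xa : ℝ) : ℝ :=
  (if y < M.qmMax then 1 else 0) * M.Lamm xb - (if -M.qmMax < y then 1 else 0) * M.Lamm xa

/-- The permanent-impact drift `κ ∫ netRate (y, δᵇ(y,z), δᵃ(y,z)) π(dy,dz)`. -/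
def impact (M : MarketModel) (δb δa π : ℤ → ℤ → ℝ) : ℝ :=
  M.κ * M.integ (fun y z => M.netRate y (δb y z) (δa y z)) π

/-- `H (d, z, z') = d + z' - z`. -/
def gain (d z z' : ℝ) : ℝ := d + z' - z

/-- Hamiltonian of the market-maker; `δb`, `δa` are the quotes of the market-takers as functions
of inventory and signal, and `π` is their law. -/
def hamMaker (M : MarketModel) (q : ℤ) (d₁ d₂ z z₁ z₂ : ℝ) (δb δa π : ℤ → ℤ → ℝ) : ℝ :=
  (if q < M.qMax then 1 else 0) * M.Lam (M.integ δa π) d₁ * gain d₁ z z₁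
    + (if -M.qMax < q then 1 else 0) * M.Lam (M.integ δb π) d₂ * gain d₂ z z₂

/-- Hamiltonian of the representative market-taker. -/
def hamTaker (M : MarketModel) (qm : ℤ) (d₁ d₂ z z₁ z₂ : ℝ) : ℝ :=
  (if qm < M.qmMax then 1 else 0) * M.Lamm d₁ * gain d₁ z z₁
    + (if -M.qmMax < qm then 1 else 0) * M.Lamm d₂ * gain d₂ z z₂

/-- Generator of the signal. -/
def genSignal (M : MarketModel) (b : ℤ) (z z₁ z₂ : ℝ) : ℝ :=
  (if b < M.bMax then 1 else 0) * M.lamPlus * (z₁ - z)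
    + (if -M.bMax < b then 1 else 0) * M.lamMinus * (z₂ - z)

/-- The terms other than `∂ₜ p` in the Fokker–Planck equation, for the quotes `δb`, `δa`. -/
def fokkerPlanck (M : MarketModel) (δb δa π : ℤ → ℤ → ℝ) (q b : ℤ) : ℝ :=
  - (if -M.qmMax < q then 1 else 0) * M.Lamm (δb (q - 1) b) * π (q - 1) b
    - (if q < M.qmMax then 1 else 0) * M.Lamm (δa (q + 1) b) * π (q + 1) b
    - M.lamPlus * (if -M.bMax < b then 1 else 0) * π q (b - 1)
    - M.lamMinus * (if b < M.bMax then 1 else 0) * π q (b + 1)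
    + ((if q < M.qmMax then 1 else 0) * M.Lamm (δb q b)
        + (if -M.qmMax < q then 1 else 0) * M.Lamm (δa q b)
        + M.lamMinus * (if -M.bMax < b then 1 else 0)
        + M.lamPlus * (if b < M.bMax then 1 else 0)) * π q b

/-- The maximiser of the Hamiltonian of the market-maker, `x ↦ σ/k + x`. -/
def dbar (M : MarketModel) (x : ℝ) : ℝ := M.σ / M.k + x

/-- The maximiser of the Hamiltonian of the market-taker, `x ↦ σ/kᵐ + x`. -/
def dmbar (M : MarketModel) (x : ℝ) : ℝ := M.σ / M.km + x

/-- Projection of a quote on `[-δ∞, δ∞]`. -/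
def clamp (δinf x : ℝ) : ℝ := max (-δinf) (min δinf x)

/-- Bid quote of a market-taker with inventory `q`, signal `b` and value function `w`. -/
def takerBid (fm : ℝ → ℝ) (w : ℤ → ℤ → ℝ) (q b : ℤ) : ℝ := fm (w q b - w (q + 1) b)

/-- Ask quote of a market-taker with inventory `q`, signal `b` and value function `w`. -/
def takerAsk (fm : ℝ → ℝ) (w : ℤ → ℤ → ℝ) (q b : ℤ) : ℝ := fm (w q b - w (q - 1) b)

/-- `(W, Wm, p)` solves the master equation on `[0, T]`, where `f` and `fm` are the feedback maps
of the market-maker and of the market-takers. Functions are indexed by all integers, and every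
condition is on the grid; `∂ₜ` is the derivative on `[0, T]`, one-sided at the end points.

The only values of `W`, `Wm`, `p` off the grid which matter are those of `Wm` at the inventories
`±(qmMax + 1)`: they fix the quotes of a market-taker on the side on which the risk limit forbids
him to trade, which enter nothing but the mean quotes seen by the market-maker. They are
prescribed, as functions `ePlus`, `eMinus` of time, signal and the value of `Wm` at the
neighbouring point of the grid. -/
structure IsMasterSolution (M : MarketModel) (f fm : ℝ → ℝ) (ePlus eMinus : ℝ → ℤ → ℝ → ℝ)
    (P₀ : ℤ → ℤ → ℝ) (W : ℝ → ℤ → ℝ) (Wm p : ℝ → ℤ → ℤ → ℝ) : Prop where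
  contDiff_W : ∀ q ∈ M.gridQ, ContDiffOn ℝ 1 (fun t => W t q) (Icc 0 M.T)
  contDiff_Wm : ∀ q ∈ M.gridQm, ∀ b ∈ M.gridB, ContDiffOn ℝ 1 (fun t => Wm t q b) (Icc 0 M.T)
  contDiff_p : ∀ q ∈ M.gridQm, ∀ b ∈ M.gridB, ContDiffOn ℝ 1 (fun t => p t q b) (Icc 0 M.T)
  bounded_W : ∃ C, ∀ t ∈ Icc 0 M.T, ∀ q ∈ M.gridQ, |W t q| ≤ C
  bounded_Wm : ∃ C, ∀ t ∈ Icc 0 M.T, ∀ q ∈ M.gridQm, ∀ b ∈ M.gridB, |Wm t q b| ≤ C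
  bounded_p : ∃ C, ∀ t ∈ Icc 0 M.T, ∀ q ∈ M.gridQm, ∀ b ∈ M.gridB, |p t q b| ≤ C
  /-- `p t` is the mass function of a probability on the grid. -/
  pmf : ∀ t ∈ Icc 0 M.T, M.IsPMF (p t)
  ghost_plus : ∀ t ∈ Icc 0 M.T, ∀ b ∈ M.gridB,
    Wm t (M.qmMax + 1) b = ePlus t b (Wm t M.qmMax b)
  ghost_minus : ∀ t ∈ Icc 0 M.T, ∀ b ∈ M.gridB,
    Wm t (-M.qmMax - 1) b = eMinus t b (Wm t (-M.qmMax) b)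
  /-- Hamilton–Jacobi–Bellman equation of the market-maker. -/
  hjb_maker : ∀ t ∈ Icc 0 M.T, ∀ q ∈ M.gridQ,
    0 = derivWithin (fun s => W s q) (Icc 0 M.T) t - M.φ * M.σ ^ 2 * (q : ℝ) ^ 2
      + q * M.impact (takerBid fm (Wm t)) (takerAsk fm (Wm t)) (p t)
      + M.hamMaker q (f (W t q - W t (q + 1))) (f (W t q - W t (q - 1)))
          (W t q) (W t (q + 1)) (W t (q - 1))
          (takerBid fm (Wm t)) (takerAsk fm (Wm t)) (p t)
  /-- Hamilton–Jacobi–Bellman equation of the representative market-taker. -/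
  hjb_taker : ∀ t ∈ Icc 0 M.T, ∀ q ∈ M.gridQm, ∀ b ∈ M.gridB,
    0 = derivWithin (fun s => Wm s q b) (Icc 0 M.T) t - M.γ * M.σ ^ 2 * (q : ℝ) ^ 2
      + (b : ℝ) * q + M.genSignal b (Wm t q b) (Wm t q (b + 1)) (Wm t q (b - 1))
      + q * M.impact (takerBid fm (Wm t)) (takerAsk fm (Wm t)) (p t)
      + M.hamTaker q (fm (Wm t q b - Wm t (q + 1) b)) (fm (Wm t q b - Wm t (q - 1) b))
          (Wm t q b) (Wm t (q + 1) b) (Wm t (q - 1) b)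
  /-- Fokker–Planck equation. -/
  fokker_planck : ∀ t ∈ Icc 0 M.T, ∀ q ∈ M.gridQm, ∀ b ∈ M.gridB,
    0 = derivWithin (fun s => p s q b) (Icc 0 M.T) t
      + M.fokkerPlanck (takerBid fm (Wm t)) (takerAsk fm (Wm t)) (p t) q b
  initial_p : ∀ q ∈ M.gridQm, ∀ b ∈ M.gridB, p 0 q b = P₀ q b
  terminal_W : ∀ q ∈ M.gridQ, W M.T q = 0
  terminal_Wm : ∀ q ∈ M.gridQm, ∀ b ∈ M.gridB, Wm M.T q b = 0

end MarketModel

end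

/-! The market-takers' equations do not involve `W`. They form a closed forward-backward system for
`(Wm, p)`; once it is solved, the market-maker's equation is a terminal value problem whose
coefficients are known continuous functions of time.

Both problems are first solved with the state truncated to a box. The field is then bounded, and
Schauder's theorem applies to the operator that integrates each component from the time at which its
value is prescribed (`exists_solution_multipoint`), for a horizon of any length and without a
Lipschitz condition. Schauder's theorem is reduced to Brouwer's, which follows from the absence of a
`C¹` retraction of the ball on the sphere.

It remains to show that the truncation is inactive. For `p` this is positivity and conservation of
mass. For `Wm` the obstacle is the impact `I`: it is exponential in the quotes, so estimating it
through the truncation level would be circular. But `I` is `κ` times the derivative of the mean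
inventory `m` (`sum_inventory_mul_fokkerPlanck`), and `m` is bounded by the risk limit. Hence `U =
Wm + q κ (m(t) - m(T))` solves an equation without `I`. At an extremum of `U` over the grid, the
differences of `Wm` between neighbours have a one-sided bound, which is exactly what `IsFeedback`
needs to control the Hamiltonian. The maximum principle `abs_le_of_deriv_bounds_at_extrema` then
bounds `U`, and so `Wm`, independently of the truncation. For `W` the impact is already a bounded
source, and the same principle applies directly. The affine and the clamped feedback maps both
satisfy `IsFeedback`. -/

noncomputable section

/-! ### Brouwer's fixed point theorem, by an analytic proof. -/

section Brouwer

open MeasureTheory Polynomial Module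

/-- Lagrange interpolation: the weights do not depend on the polynomial. An identity known for small
parameters, and integrated over a family of polynomials of bounded degree, can thus be carried to
the parameter 1. -/
lemma exists_interpolation_weights (N : ℕ) {c : ℝ} (hc : 0 < c) :
    ∃ w t : Fin (N + 1) → ℝ, (∀ i, 0 < t i ∧ t i < c) ∧
      ∀ p : ℝ[X], p.natDegree ≤ N → p.eval 1 = ∑ i, w i * p.eval (t i) := by
  -- The shift by 2 keeps every node, including the one of index 0, strictly below `c`.
  let t : Fin (N + 1) → ℝ := fun i => c / ((i : ℕ) + 2)
  have ht : Set.InjOn t (Finset.univ : Finset (Fin (N + 1))) := by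
    intro i _ j _ h
    have h1 : (0 : ℝ) < (i : ℕ) + 2 := by positivity
    have h2 : (0 : ℝ) < (j : ℕ) + 2 := by positivity
    simp only [t] at h
    rw [div_eq_div_iff h1.ne' h2.ne'] at h
    have h3 := mul_left_cancel₀ hc.ne' h
    have h4 : ((i : ℕ) : ℝ) = (j : ℕ) := by linarith
    exact Fin.ext (by exact_mod_cast h4)
  refine ⟨fun i => (Lagrange.basis Finset.univ t i).eval 1, t, fun i => ⟨by positivity, ?_⟩, ?_⟩
  · have h1 : (0 : ℝ) ≤ (i : ℕ) := by positivity
    rw [div_lt_iff₀ (by positivity)]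
    nlinarith
  · intro p hp
    have hd : p.degree < (Finset.univ : Finset (Fin (N + 1))).card := by
      rw [Finset.card_univ, Fintype.card_fin]
      exact lt_of_le_of_lt p.degree_le_natDegree (by exact_mod_cast Nat.lt_succ_of_le hp)
    conv_lhs => rw [Lagrange.eq_interpolate ht hd, Lagrange.interpolate_apply]
    rw [eval_finsetSum]
    exact Finset.sum_congr rfl fun i _ => by rw [eval_mul, eval_C, mul_comm]

variable {E : Type*} [NormedAddCommGroup E] [InnerProductSpace ℝ E] [FiniteDimensional ℝ E]

lemma exists_polynomial_eval_eq_det (A : E →L[ℝ] E) :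
    ∃ p : ℝ[X], p.natDegree ≤ finrank ℝ E ∧
      ∀ t : ℝ, p.eval t = (ContinuousLinearMap.id ℝ E + t • A).det := by
  classical
  let b := finBasis ℝ E
  let M := LinearMap.toMatrix b b (A : E →ₗ[ℝ] E)
  refine ⟨Matrix.det ((X : ℝ[X]) • M.map C + (1 : Matrix _ _ ℝ).map C), ?_, fun t => ?_⟩
  · simpa using natDegree_det_X_add_C_le M 1
  · rw [eval_det, ContinuousLinearMap.det, ← LinearMap.det_toMatrix b]
    congr 1
    ext i j
    rw [matPolyEquiv_eval]
    simp [M, LinearMap.toMatrix_apply, Matrix.one_apply, Finsupp.single_apply, add_comm, eq_comm]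
    split_ifs <;> simp [mul_comm]

lemma det_id_add_ne_zero {A : E →L[ℝ] E} (hA : ‖A‖ < 1) :
    (ContinuousLinearMap.id ℝ E + A).det ≠ 0 := by
  intro h
  have h2 := LinearMap.bot_lt_ker_of_det_eq_zero (f := ((ContinuousLinearMap.id ℝ E + A :
    E →L[ℝ] E) : E →ₗ[ℝ] E)) h
  obtain ⟨v, hv, hv0⟩ := (Submodule.ne_bot_iff _).1 h2.ne'
  have h3 : v + A v = 0 := by simpa using hv
  have h4 : ‖v‖ = ‖A v‖ := by conv_lhs => rw [eq_neg_of_add_eq_zero_left h3, norm_neg]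
  have h5 := A.le_opNorm v
  have h6 : 0 < ‖v‖ := norm_pos_iff.2 hv0
  nlinarith

/-- The determinant of `1 + sA` equals 1 at `s = 0` and has no zero for `s` in `[0, 1]`, so it
cannot change sign. -/
lemma det_id_add_pos {A : E →L[ℝ] E} (hA : ‖A‖ < 1) :
    0 < (ContinuousLinearMap.id ℝ E + A).det := by
  obtain ⟨p, -, hp⟩ := exists_polynomial_eval_eq_det A
  by_contra! hneg
  have h1 : p.eval 1 ≤ 0 := by simpa [hp] using hneg
  have h0 : p.eval 0 = 1 := by simp [hp, ContinuousLinearMap.det]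
  obtain ⟨s, hs, hs0⟩ := intermediate_value_Icc' (zero_le_one' ℝ) p.continuous.continuousOn
    (show (0 : ℝ) ∈ Icc (p.eval 1) (p.eval 0) from ⟨h1, by rw [h0]; exact zero_le_one⟩)
  simp only [hp] at hs0
  refine det_id_add_ne_zero ?_ hs0
  rw [norm_smul, Real.norm_of_nonneg hs.1]
  nlinarith [norm_nonneg A, hs.2]

/-- There is no `C¹` retraction of the ball on the sphere. -/
theorem no_contDiffAt_retraction (r : E → E)
    (hr : ∀ x ∈ Metric.closedBall (0 : E) 1, ContDiffAt ℝ 1 r x)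
    (hr1 : ∀ x ∈ Metric.closedBall (0 : E) 1, ‖r x‖ = 1)
    (hrs : ∀ x, ‖x‖ = 1 → r x = x) : False := by
  borelize E
  set B : Set E := Metric.closedBall 0 1
  set B₀ : Set E := Metric.ball 0 1
  have hB₀B : B₀ ⊆ B := Metric.ball_subset_closedBall
  have hBc : IsCompact B := isCompact_closedBall _ _
  set g : E → E := fun x => r x - x
  have hg : ∀ x ∈ B, ContDiffAt ℝ 1 g x := fun x hx => (hr x hx).sub contDiffAt_id
  have hgd : ∀ x ∈ B, HasStrictFDerivAt g (fderiv ℝ g x) x := fun x hx =>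
    (hg x hx).hasStrictFDerivAt (by simp)
  have hgc : ContinuousOn (fderiv ℝ g) B := fun x hx =>
    (((hg x hx).fderiv_right (m := 0) (by simp)).continuousAt).continuousWithinAt
  obtain ⟨C₀, hC₀⟩ := hBc.exists_bound_of_continuousOn hgc
  set C : ℝ := max C₀ 1
  have hC1 : 1 ≤ C := le_max_right _ _
  have hC : ∀ x ∈ B, ‖fderiv ℝ g x‖ ≤ C := fun x hx => (hC₀ x hx).trans (le_max_left _ _)
  have hlip : ∀ x ∈ B, ∀ y ∈ B, ‖g y - g x‖ ≤ C * ‖y - x‖ := fun x hx y hy =>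
    (convex_closedBall (0 : E) 1).norm_image_sub_le_of_norm_fderiv_le
      (fun z hz => (hgd z hz).hasFDerivAt.differentiableAt) hC hx hy
  -- `F t` interpolates between the identity and `r = F 1`. For `t < 1/C` it permutes the open ball,
  -- so the integral of its Jacobian is the volume of the ball. That integral is polynomial in `t`,
  -- so it has this value at `t = 1` too, where the Jacobian vanishes.
  let D : ℝ → E → (E →L[ℝ] E) := fun t x => ContinuousLinearMap.id ℝ E + t • fderiv ℝ g x
  let F : ℝ → E → E := fun t x => x + t • g x
  have hF : ∀ t, ∀ x ∈ B, HasStrictFDerivAt (F t) (D t x) x := fun t x hx =>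
    (hasStrictFDerivAt_id x).add ((hgd x hx).const_smul t)
  have hDint : ∀ t, IntegrableOn (fun x => (D t x).det) B₀ := fun t => by
    have h1 : ContinuousOn (fun x => (D t x).det) B :=
      ContinuousLinearMap.continuous_det.comp_continuousOn
        (continuousOn_const.add (hgc.const_smul t))
    exact (h1.integrableOn_compact hBc).mono_set hB₀B
  have hpos : ∀ t, 0 < t → t < C⁻¹ → ∀ x ∈ B, 0 < (D t x).det := by
    intro t ht htc x hx
    refine det_id_add_pos ?_
    rw [norm_smul, Real.norm_of_nonneg ht.le]
    calc t * ‖fderiv ℝ g x‖ ≤ t * C := by gcongr; exact hC x hx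
      _ < C⁻¹ * C := by gcongr
      _ = 1 := inv_mul_cancel₀ (by positivity)
  have hinj : ∀ t, 0 < t → t < C⁻¹ → InjOn (F t) B := by
    intro t ht htc x hx y hy hxy
    by_contra hne
    have h1 : y - x = - (t • (g y - g x)) := by
      simp only [F] at hxy
      rw [smul_sub, neg_sub, sub_eq_sub_iff_add_eq_add, ← hxy]
      abel
    have h2 : ‖y - x‖ ≤ t * (C * ‖y - x‖) := by
      conv_lhs => rw [h1, norm_neg, norm_smul, Real.norm_of_nonneg ht.le]
      gcongr
      exact hlip x hx y hy
    have h3 : 0 < ‖y - x‖ := norm_pos_iff.2 (sub_ne_zero.2 (Ne.symm hne))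
    have h4 : t * C < 1 := by
      calc t * C < C⁻¹ * C := by gcongr
        _ = 1 := inv_mul_cancel₀ (by positivity)
    nlinarith
  have himage : ∀ t, 0 < t → t < C⁻¹ → F t '' B₀ = B₀ := by
    intro t ht htc
    have ht1 : t ≤ 1 := htc.le.trans (inv_le_one_of_one_le₀ hC1)
    have hopen : IsOpen (F t '' B₀) := by
      rw [isOpen_iff_mem_nhds]
      rintro _ ⟨x, hx, rfl⟩
      have hs := (hF t x (hB₀B hx)).map_nhds_eq_of_surj (by
        have h1 : IsUnit (LinearMap.det ((D t x : E →L[ℝ] E) : E →ₗ[ℝ] E)) :=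
          (hpos t ht htc x (hB₀B hx)).ne'.isUnit
        exact (LinearMap.range_eq_top).2
          ((LinearMap.isUnit_iff_isUnit_det _).2 h1 |> (Module.End.isUnit_iff _).1).2)
      rw [← hs]
      exact Filter.image_mem_map (Metric.isOpen_ball.mem_nhds hx)
    have hmaps : F t '' B ⊆ B := by
      rintro _ ⟨x, hx, rfl⟩
      have h1 : F t x = (1 - t) • x + t • r x := by
        simp only [F, g, smul_sub, sub_smul, one_smul]; abel
      rw [h1, mem_closedBall_zero_iff]
      have hx1 : ‖x‖ ≤ 1 := mem_closedBall_zero_iff.1 hx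
      calc ‖(1 - t) • x + t • r x‖ ≤ (1 - t) * ‖x‖ + t * ‖r x‖ := by
            refine (norm_add_le _ _).trans_eq ?_
            rw [norm_smul, norm_smul, Real.norm_of_nonneg ht.le,
              Real.norm_of_nonneg (sub_nonneg.2 ht1)]
        _ ≤ 1 := by rw [hr1 x hx]; nlinarith
    have hsub : F t '' B₀ ⊆ B₀ := by
      have h1 : F t '' B₀ ⊆ interior B :=
        interior_maximal ((image_mono hB₀B).trans hmaps) hopen
      -- In dimension 0 the closed ball of radius 1 is the whole space, and its interior is not
      -- described by `interior_closedBall`.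
      rcases subsingleton_or_nontrivial E with hE | hE
      · intro y _
        rw [Subsingleton.elim y 0]
        exact Metric.mem_ball_self one_pos
      · rwa [interior_closedBall _ one_ne_zero] at h1
    -- Points of the sphere are fixed by `F t`, so a point of the open ball reached from the closed
    -- ball is reached from the open one. The image of the open ball is therefore open and
    -- relatively closed in a connected set.
    have hclosed : F t '' B₀ = F t '' B ∩ B₀ := by
      refine Subset.antisymm (subset_inter (image_mono hB₀B) hsub) ?_
      rintro _ ⟨⟨x, hx, rfl⟩, hx2⟩
      refine ⟨x, ?_, rfl⟩
      by_contra hx3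
      have hx4 : ‖x‖ = 1 := le_antisymm (mem_closedBall_zero_iff.1 hx)
        (not_lt.1 fun h => hx3 (mem_ball_zero_iff.2 h))
      have hx5 : F t x = x := by simp [F, g, hrs x hx4]
      rw [hx5] at hx2
      exact hx3 hx2
    have hcl : IsClosed (F t '' B) := (hBc.image_of_continuousOn fun x hx =>
      (hF t x hx).hasFDerivAt.continuousAt.continuousWithinAt).isClosed
    have hconn : IsPreconnected B₀ := (convex_ball (0 : E) 1).isPreconnected
    refine Subset.antisymm hsub ?_
    have hne : (B₀ ∩ F t '' B₀).Nonempty :=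
      ⟨F t 0, hsub ⟨0, Metric.mem_ball_self one_pos, rfl⟩, 0, Metric.mem_ball_self one_pos, rfl⟩
    refine hconn.subset_of_closure_inter_subset hopen hne ?_
    rintro y ⟨hy1, hy2⟩
    rw [hclosed]
    exact ⟨hcl.closure_subset_iff.2 (image_mono hB₀B) hy1, hy2⟩
  have hvol : ∀ t, 0 < t → t < C⁻¹ → ∫ x in B₀, (D t x).det = volume.real B₀ := by
    intro t ht htc
    have h1 := integral_image_eq_integral_abs_det_fderiv_smul volume
      (measurableSet_ball : MeasurableSet B₀)
      (fun x hx => (hF t x (hB₀B hx)).hasFDerivAt.hasFDerivWithinAt)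
      ((hinj t ht htc).mono hB₀B) (fun _ => (1 : ℝ))
    rw [himage t ht htc] at h1
    simp only [smul_eq_mul, mul_one, integral_const, MeasurableSet.univ,
      measureReal_restrict_apply, univ_inter] at h1
    rw [h1]
    exact setIntegral_congr_fun measurableSet_ball
      fun x hx => (abs_of_pos (hpos t ht htc x (hB₀B hx))).symm
  obtain ⟨w, τ, hτ, hw⟩ := exists_interpolation_weights (finrank ℝ E)
    (inv_pos.2 (zero_lt_one.trans_le hC1))
  have hdet1 : ∀ x, (D 1 x).det = ∑ i, w i * (D (τ i) x).det := by
    intro x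
    obtain ⟨p, hp1, hp2⟩ := exists_polynomial_eval_eq_det (fderiv ℝ g x)
    simpa only [hp2] using hw p hp1
  have hwsum : ∑ i, w i = 1 := by simpa using (hw 1 (by simp)).symm
  have hone : ∫ x in B₀, (D 1 x).det = volume.real B₀ := by
    simp_rw [hdet1]
    rw [integral_finsetSum _ fun i _ => (hDint (τ i)).const_mul _]
    simp_rw [integral_const_mul, fun i => hvol (τ i) (hτ i).1 (hτ i).2, ← Finset.sum_mul, hwsum,
      one_mul]
  -- Differentiating `‖r‖² = 1` shows that the range of the derivative is orthogonal to `r x`, so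
  -- the nonzero vector `r x` is not attained.
  have hzero : ∀ x ∈ B₀, (D 1 x).det = 0 := by
    intro x hx
    have hDr : HasFDerivAt r (D 1 x) x := by
      have h1 := (hF 1 x (hB₀B hx)).hasFDerivAt
      have h2 : F 1 = r := by funext y; simp [F, g]
      rwa [h2] at h1
    have h3 : HasFDerivAt (fun y => inner ℝ (r y) (r y)) (0 : E →L[ℝ] ℝ) x := by
      refine (hasFDerivAt_const (1 : ℝ) x).congr_of_eventuallyEq ?_
      filter_upwards [Metric.isOpen_ball.mem_nhds hx] with y hy
      rw [real_inner_self_eq_norm_sq, hr1 y (hB₀B hy), one_pow]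
    have h4 := h3.unique (hDr.inner ℝ hDr)
    have h5 : ∀ v, inner ℝ (r x) (D 1 x v) = 0 := by
      intro v
      have h6 := congrArg (fun L : E →L[ℝ] ℝ => L v) h4
      simp only [zero_apply, ContinuousLinearMap.comp_apply,
        ContinuousLinearMap.prod_apply, fderivInnerCLM_apply] at h6
      rw [real_inner_comm (r x) (D 1 x v)] at h6
      have h7 := real_inner_comm (r x) (D 1 x v)
      linarith
    by_contra hne
    have h1 : IsUnit (LinearMap.det ((D 1 x : E →L[ℝ] E) : E →ₗ[ℝ] E)) := Ne.isUnit hne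
    obtain ⟨v, hv⟩ := ((LinearMap.isUnit_iff_isUnit_det _).2 h1 |> (Module.End.isUnit_iff _).1).2
      (r x)
    have h8 := h5 v
    have h9 : D 1 x v = r x := hv
    rw [h9, real_inner_self_eq_norm_sq, hr1 x (hB₀B hx)] at h8
    norm_num at h8
  have hz : ∫ x in B₀, (D 1 x).det = 0 := by
    rw [setIntegral_congr_fun measurableSet_ball hzero]; simp
  have hv0 : 0 < volume.real B₀ := by
    rw [measureReal_def, ENNReal.toReal_pos_iff]
    exact ⟨Metric.measure_ball_pos _ _ one_pos, measure_ball_lt_top⟩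
  rw [hz] at hone
  exact hv0.ne hone

/-- **Brouwer's fixed point theorem**, for a map of the space into its unit ball. -/
theorem exists_fixedPoint_of_norm_le_one (f : E → E) (hf : Continuous f) (hf1 : ∀ x, ‖f x‖ ≤ 1) :
    ∃ x, f x = x := by
  by_contra! hne
  have hBc : IsCompact (Metric.closedBall (0 : E) 1) := isCompact_closedBall _ _
  obtain ⟨x₀, -, hx₀⟩ := hBc.exists_isMinOn ⟨0, Metric.mem_closedBall_self zero_le_one⟩
    (f := fun x => ‖f x - x‖) (by fun_prop)
  set μ := ‖f x₀ - x₀‖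
  have hμ : 0 < μ := norm_pos_iff.2 (sub_ne_zero.2 (hne x₀))
  -- Smoothing and rescaling each move the value by at most `ε`, so a displacement of at least `4ε`
  -- does not vanish.
  set ε := μ / 4
  have hε : 0 < ε := by positivity
  obtain ⟨g₀, hg₀, hg₀f, -⟩ := hf.exists_contDiff_approx 1 (ε := fun _ => ε) continuous_const
    (fun _ => hε)
  let g : E → E := fun x => (1 + ε)⁻¹ • g₀ x
  have hg : ContDiff ℝ 1 g := contDiff_const.smul (by exact_mod_cast hg₀)
  have hg1 : ∀ x, ‖g x‖ ≤ 1 := fun x => by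
    have h1 : ‖g₀ x‖ ≤ 1 + ε := by
      have h2 := norm_le_insert' (g₀ x) (f x)
      have h3 := hg₀f x
      rw [dist_eq_norm] at h3
      linarith [hf1 x]
    rw [norm_smul, Real.norm_of_nonneg (by positivity)]
    calc (1 + ε)⁻¹ * ‖g₀ x‖ ≤ (1 + ε)⁻¹ * (1 + ε) := by gcongr
      _ = 1 := inv_mul_cancel₀ (by positivity)
  have hgx : ∀ x ∈ Metric.closedBall (0 : E) 1, 0 < ‖x - g x‖ := fun x hx => by
    have h1 : μ ≤ ‖f x - x‖ := hx₀ hx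
    have h2 : ‖f x - g₀ x‖ < ε := by rw [← dist_eq_norm, dist_comm]; exact hg₀f x
    have h3 : g₀ x - g x = ε • g x := by
      have h4 : g₀ x = (1 + ε) • g x := by
        simp only [g, smul_smul, mul_inv_cancel₀ (by positivity : 1 + ε ≠ 0), one_smul]
      conv_lhs => rw [h4]
      rw [add_smul, one_smul, add_sub_cancel_left]
    have h4 : ‖g₀ x - g x‖ ≤ ε := by
      rw [h3, norm_smul, Real.norm_of_nonneg hε.le]
      nlinarith [hg1 x]
    have h5 : f x - x = (f x - g₀ x) + (g₀ x - g x) - (x - g x) := by abel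
    have h6 : ‖f x - x‖ ≤ ‖f x - g₀ x‖ + ‖g₀ x - g x‖ + ‖x - g x‖ := by
      rw [h5]
      exact (norm_sub_le _ _).trans (by gcongr; exact norm_add_le _ _)
    have h7 : μ = 4 * ε := by simp only [ε]; ring
    linarith
  let u : E → E := fun x => x - g x
  have hu : ContDiff ℝ 1 u := contDiff_id.sub hg
  let a : E → ℝ := fun x => ‖u x‖ ^ 2
  let b : E → ℝ := fun x => inner ℝ x (u x)
  let d : E → ℝ := fun x => b x ^ 2 + a x * (1 - ‖x‖ ^ 2)
  have ha : ContDiff ℝ 1 a := hu.norm_sq ℝ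
  have hb : ContDiff ℝ 1 b := contDiff_id.inner ℝ hu
  have hd : ContDiff ℝ 1 d := (hb.pow 2).add (ha.mul (contDiff_const.sub (contDiff_id.norm_sq ℝ)))
  have hapos : ∀ x ∈ Metric.closedBall (0 : E) 1, 0 < a x := fun x hx => pow_pos (hgx x hx) 2
  -- On the sphere `2 b = a + 1 - ‖g x‖² ≥ a > 0`: the outward direction `u` is never tangent.
  have hbpos : ∀ x, ‖x‖ = 1 → 0 < b x := fun x hx => by
    have h1 := hapos x (mem_closedBall_zero_iff.2 hx.le)
    have h2 : a x = ‖x‖ ^ 2 - 2 * inner ℝ x (g x) + ‖g x‖ ^ 2 := norm_sub_sq_real _ _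
    have h3 : b x = ‖x‖ ^ 2 - inner ℝ x (g x) := by
      simp only [b, u, inner_sub_right, real_inner_self_eq_norm_sq]
    have h4 : ‖g x‖ ^ 2 ≤ 1 := pow_le_one₀ (norm_nonneg _) (hg1 x)
    rw [hx] at h2 h3
    linarith
  have hdpos : ∀ x ∈ Metric.closedBall (0 : E) 1, 0 < d x := fun x hx => by
    rcases (mem_closedBall_zero_iff.1 hx).lt_or_eq with h | h
    · have h1 : 0 < 1 - ‖x‖ ^ 2 := by nlinarith [norm_nonneg x]
      have h2 := mul_pos (hapos x hx) h1
      have h3 := sq_nonneg (b x)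
      simp only [d]
      linarith
    · have h1 : 0 < b x ^ 2 := pow_pos (hbpos x h) 2
      simpa [d, h] using h1
  -- The larger root of `a l² + 2 b l + ‖x‖² - 1 = 0`: the ray from `x` away from `g x` leaves the
  -- ball at `x + l u`. On the ball `d > 0`, so `l` is smooth; on the sphere `b > 0` gives `l = 0`.
  let l : E → ℝ := fun x => (-b x + √(d x)) / a x
  refine no_contDiffAt_retraction (fun x => x + l x • u x) (fun x hx => ?_) (fun x hx => ?_)
    fun x hx => ?_
  · exact contDiffAt_id.add (((hb.contDiffAt.neg.add
      (hd.contDiffAt.sqrt (hdpos x hx).ne')).div ha.contDiffAt (hapos x hx).ne').smul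
        hu.contDiffAt)
  · have h1 : ‖x + l x • u x‖ ^ 2 = ‖x‖ ^ 2 + 2 * (l x * b x) + l x ^ 2 * a x := by
      rw [norm_add_sq_real, inner_smul_right, norm_smul, mul_pow, Real.norm_eq_abs, sq_abs]
    have h2 : l x * a x = -b x + √(d x) := div_mul_cancel₀ _ (hapos x hx).ne'
    have h3 : √(d x) ^ 2 = d x := Real.sq_sqrt (hdpos x hx).le
    have h4 : a x * (‖x + l x • u x‖ ^ 2 - 1) = 0 := by
      rw [h1]
      have h5 : √(d x) = l x * a x + b x := by linarith
      rw [h5] at h3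
      simp only [d] at h3
      linear_combination h3
    have h5 : ‖x + l x • u x‖ ^ 2 = 1 := by
      have := (mul_eq_zero.1 h4).resolve_left (hapos x hx).ne'
      linarith
    exact (pow_eq_one_iff_of_nonneg (norm_nonneg _) two_ne_zero).1 h5
  · have h1 : d x = b x ^ 2 := by simp [d, hx]
    have h2 : l x = 0 := by simp [l, h1, Real.sqrt_sq (hbpos x hx).le]
    simp [h2]

end Brouwer
end

noncomputable section

/-! ### Schauder's fixed point theorem for compact convex sets. -/

section Schauder

variable {X : Type*} [NormedAddCommGroup X] [NormedSpace ℝ X]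

/-- Schauder projection: `f` is replaced by weights on a finite `ε`-net, and Brouwer's theorem is
applied to the weights. -/
lemma exists_dist_le_of_isCompact_convex {K : Set X} (hKc : IsCompact K) (hKconv : Convex ℝ K)
    (hKne : K.Nonempty) {f : X → X} (hf : ContinuousOn f K) (hfK : MapsTo f K K) {ε : ℝ}
    (hε : 0 < ε) : ∃ x ∈ K, dist (f x) x ≤ ε := by
  classical
  obtain ⟨x₀, hx₀⟩ := hKne
  obtain ⟨t₀, ht₀K, ht₀f, ht₀⟩ := hKc.finite_cover_balls hε
  lift t₀ to Finset X using ht₀f with t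
  let S : EuclideanSpace ℝ t → ℝ := fun s => ∑ i, max (s i) 0
  let N : EuclideanSpace ℝ t → ℝ := fun s => max 1 (S s)
  have hS : Continuous S := by fun_prop
  have hN : Continuous N := by fun_prop
  have hNpos : ∀ s, 0 < N s := fun s => zero_lt_one.trans_le (le_max_left _ _)
  -- This extends the barycentric map of the simplex to all of the Euclidean space, with values in
  -- `K`: negative coordinates are cut, excess mass is normalised and missing mass is put on `x₀`.
  let Q : EuclideanSpace ℝ t → X := fun s =>
    ((N s - S s) / N s) • x₀ + ∑ i : t, (max (s i) 0 / N s) • (i : X)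
  have hQ : Continuous Q := by
    refine ((((hN.sub hS).div hN fun s => (hNpos s).ne')).smul continuous_const).add
      (continuous_finsetSum _ fun i _ => ?_)
    exact (Continuous.div (by fun_prop) hN fun s => (hNpos s).ne').smul continuous_const
  have hQK : ∀ s, Q s ∈ K := fun s => by
    let c : Option t → ℝ := fun o => o.elim ((N s - S s) / N s) fun i => max (s i) 0 / N s
    let z : Option t → X := fun o => o.elim x₀ fun i => (i : X)
    have h1 : ∑ o, c o • z o ∈ K := by
      refine hKconv.sum_mem (fun o _ => ?_) ?_ fun o _ => ?_
      · cases o with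
        | none => exact div_nonneg (sub_nonneg.2 (le_max_right _ _)) (hNpos s).le
        | some i => exact div_nonneg (le_max_right _ _) (hNpos s).le
      · rw [Fintype.sum_option]
        simp only [c, Option.elim]
        rw [← Finset.sum_div, ← add_div]
        exact (div_eq_one_iff_eq (hNpos s).ne').2 (by simp [S])
      · cases o with
        | none => exact hx₀
        | some i => exact ht₀K i.2
    rwa [Fintype.sum_option] at h1
  let w : X → t → ℝ := fun y i => max 0 (ε - dist y i)
  have hw0 : ∀ y i, 0 ≤ w y i := fun y i => le_max_left _ _
  have hwc : ∀ i, Continuous fun y => w y i := fun i => by fun_prop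
  let V : X → ℝ := fun y => ∑ i, w y i
  have hVc : Continuous V := continuous_finsetSum _ fun i _ => hwc i
  have hV : ∀ y ∈ K, 0 < V y := fun y hy => by
    obtain ⟨x, hx, hyx⟩ := mem_iUnion₂.1 (ht₀ hy)
    refine Finset.sum_pos' (fun i _ => hw0 y i) ⟨⟨x, hx⟩, Finset.mem_univ _, ?_⟩
    exact lt_max_of_lt_right (sub_pos.2 hyx)
  have hfQ : Continuous fun s => f (Q s) := hf.comp_continuous hQ hQK
  have hfQK : ∀ s, f (Q s) ∈ K := fun s => hfK (hQK s)
  let F : EuclideanSpace ℝ t → EuclideanSpace ℝ t := fun s =>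
    WithLp.toLp 2 fun i => w (f (Q s)) i / V (f (Q s))
  have hF : Continuous F := by
    refine (PiLp.continuous_toLp 2 _).comp (continuous_pi fun i => ?_)
    exact ((hwc i).comp hfQ).div (hVc.comp hfQ) fun s => (hV _ (hfQK s)).ne'
  have hF0 : ∀ s i, 0 ≤ F s i := fun s i => div_nonneg (hw0 _ _) (hV _ (hfQK s)).le
  have hFsum : ∀ s, ∑ i, F s i = 1 := fun s => by
    simp only [F]
    rw [← Finset.sum_div]
    exact div_self (hV _ (hfQK s)).ne'
  have hFn : ∀ s, ‖F s‖ ≤ 1 := fun s => by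
    rw [EuclideanSpace.norm_eq, Real.sqrt_le_one, ← hFsum s]
    refine Finset.sum_le_sum fun i _ => ?_
    have h1 : F s i ≤ 1 := by
      rw [← hFsum s]
      exact Finset.single_le_sum (fun j _ => hF0 s j) (Finset.mem_univ i)
    rw [Real.norm_of_nonneg (hF0 s i)]
    nlinarith [hF0 s i]
  obtain ⟨s, hs⟩ := exists_fixedPoint_of_norm_le_one F hF hFn
  have hs0 : ∀ i, 0 ≤ s i := fun i => hs ▸ hF0 s i
  have hs1 : ∑ i, s i = 1 := by
    conv_lhs => rw [← hs]
    exact hFsum s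
  have hSs : S s = 1 := by
    simp only [S]
    rw [← hs1]
    exact Finset.sum_congr rfl fun i _ => max_eq_left (hs0 i)
  have hNs : N s = 1 := by simp [N, hSs]
  have hQs : Q s = ∑ i : t, s i • (i : X) := by
    simp only [Q, hNs, hSs, sub_self, zero_smul, zero_add, div_one]
    exact Finset.sum_congr rfl fun i _ => by rw [max_eq_left (hs0 i)]
  refine ⟨Q s, hQK s, ?_⟩
  -- A net point with nonzero weight lies within `ε` of `f (Q s)`, so this is a convex combination
  -- of short vectors.
  have h1 : f (Q s) - Q s = ∑ i : t, s i • (f (Q s) - (i : X)) := by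
    simp_rw [smul_sub]
    rw [Finset.sum_sub_distrib, ← Finset.sum_smul, hs1, one_smul, ← hQs]
  rw [dist_eq_norm, h1]
  calc ‖∑ i : t, s i • (f (Q s) - (i : X))‖ ≤ ∑ i : t, s i * ε := by
        refine (norm_sum_le _ _).trans (Finset.sum_le_sum fun i _ => ?_)
        rw [norm_smul, Real.norm_of_nonneg (hs0 i)]
        by_cases hi : dist (f (Q s)) i ≤ ε
        · rw [← dist_eq_norm]
          exact mul_le_mul_of_nonneg_left hi (hs0 i)
        · have h2 : s i = 0 := by
            have h3 : s i = F s i := by rw [hs]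
            rw [h3]
            have h4 : w (f (Q s)) i = 0 := max_eq_left (by linarith)
            simp [F, h4]
          simp [h2]
    _ = ε := by rw [← Finset.sum_mul, hs1, one_mul]

/-- **Schauder's fixed point theorem** for a compact convex set. -/
theorem exists_fixedPoint_of_isCompact_convex {K : Set X} (hKc : IsCompact K)
    (hKconv : Convex ℝ K) (hKne : K.Nonempty) {f : X → X} (hf : ContinuousOn f K)
    (hfK : MapsTo f K K) : ∃ x ∈ K, f x = x := by
  obtain ⟨x, hx, hmin⟩ := hKc.exists_isMinOn hKne (f := fun x => dist (f x) x)
    (continuous_dist.comp_continuousOn (hf.prodMk continuousOn_id))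
  refine ⟨x, hx, dist_le_zero.1 (le_of_forall_pos_le_add fun ε hε => ?_)⟩
  obtain ⟨y, hy, hyε⟩ := exists_dist_le_of_isCompact_convex hKc hKconv hKne hf hfK hε
  rw [zero_add]
  exact (hmin hy).trans hyε

end Schauder
end

noncomputable section

/-! ### Differential equations with values prescribed at different times. -/

section MultipointProblem

open MeasureTheory

/-- The Lipschitz bound gives equicontinuity, so compactness may be checked for pointwise
convergence, where the set is closed in a product of compact balls. -/
lemma isCompact_setOf_norm_le_and_dist_le {Y V : Type*} [PseudoMetricSpace Y] [CompactSpace Y]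
    [NormedAddCommGroup V] [ProperSpace V] (R L : ℝ) :
    IsCompact {x : C(Y, V) | (∀ t, ‖x t‖ ≤ R) ∧ ∀ s t, dist (x s) (x t) ≤ L * dist s t} := by
  have hequi : ∀ {x : Y → V}, (∀ s t, dist (x s) (x t) ≤ L * dist s t) →
      LipschitzWith L.toNNReal x := fun h =>
    LipschitzWith.of_dist_le_mul fun s t =>
      (h s t).trans (mul_le_mul_of_nonneg_right (Real.le_coe_toNNReal L) dist_nonneg)
  refine ArzelaAscoli.isCompact_of_equicontinuous _ ?_ ?_
  · have himage : ContinuousMap.toFun '' {x : C(Y, V) | (∀ t, ‖x t‖ ≤ R) ∧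
        ∀ s t, dist (x s) (x t) ≤ L * dist s t} =
        (univ.pi fun _ : Y => Metric.closedBall (0 : V) R) ∩
          {x | ∀ s t, dist (x s) (x t) ≤ L * dist s t} := by
      ext x
      constructor
      · rintro ⟨y, hy, rfl⟩
        exact ⟨fun t _ => mem_closedBall_zero_iff.2 (hy.1 t), hy.2⟩
      · rintro ⟨h1, h2⟩
        exact ⟨⟨x, (hequi h2).continuous⟩,
          ⟨fun t => mem_closedBall_zero_iff.1 (h1 t (mem_univ t)), h2⟩, rfl⟩
    rw [himage]
    refine (isCompact_univ_pi fun _ => isCompact_closedBall _ _).inter_right ?_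
    simp only [ofPred_forall]
    exact isClosed_iInter fun s => isClosed_iInter fun t =>
      isClosed_le ((continuous_apply s).dist (continuous_apply t)) continuous_const
  · exact (LipschitzWith.uniformEquicontinuous _ L.toNNReal fun x => hequi x.2.2).equicontinuous

/-- A system of differential equations with a bounded continuous field has a solution on `[0, T]`
whose components take prescribed values at prescribed times, one time for each component. -/
theorem exists_solution_multipoint {ι : Type*} [Fintype ι] {T : ℝ} (hT : 0 ≤ T)
    (G : ℝ → (ι → ℝ) → ι → ℝ) (hG : Continuous (Function.uncurry G)) (L : ℝ)
    (hL : ∀ t ∈ Icc 0 T, ∀ x i, |G t x i| ≤ L) (t₀ : ι → ℝ) (ht₀ : ∀ i, t₀ i ∈ Icc 0 T)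
    (x₀ : ι → ℝ) :
    ∃ x : ℝ → ι → ℝ, Continuous x ∧ (∀ i, x (t₀ i) i = x₀ i) ∧
      ∀ t ∈ Icc 0 T, ∀ i, HasDerivWithinAt (fun s => x s i) (G t (x t) i) (Icc 0 T) t := by
  rcases isEmpty_or_nonempty ι with hι | ⟨⟨i₀⟩⟩
  · exact ⟨fun _ => x₀, continuous_const, fun i => hι.elim i, fun _ _ i => hι.elim i⟩
  have hL0 : 0 ≤ L := (abs_nonneg _).trans (hL 0 ⟨le_rfl, hT⟩ 0 i₀)
  let I := Icc (0 : ℝ) T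
  -- Paths are extended by constants outside `[0, T]`, so that the integrands are continuous on the
  -- whole line.
  let xt : C(I, ι → ℝ) → ℝ → ι → ℝ := fun x s => x (projIcc 0 T hT s)
  have hxt : Continuous fun z : C(I, ι → ℝ) × ℝ => xt z.1 z.2 :=
    continuous_eval.comp (continuous_fst.prodMk ((continuous_projIcc (h := hT)).comp continuous_snd))
  have hint : ∀ i, Continuous fun z : C(I, ι → ℝ) × ℝ => G z.2 (xt z.1 z.2) i := fun i =>
    (continuous_apply i).comp (hG.comp (continuous_snd.prodMk hxt))
  have hint' : ∀ (x : C(I, ι → ℝ)) i, Continuous fun s => G s (xt x s) i := fun x i =>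
    (hint i).comp (continuous_const.prodMk continuous_id)
  -- Each component is integrated from its own time `t₀ i`, so a fixed point satisfies initial and
  -- terminal conditions simultaneously.
  let P : C(I, ι → ℝ) → ℝ → ι → ℝ := fun x t i => x₀ i + ∫ s in (t₀ i)..t, G s (xt x s) i
  have hP : Continuous fun z : C(I, ι → ℝ) × ℝ => P z.1 z.2 := by
    refine continuous_pi fun i => continuous_const.add ?_
    refine intervalIntegral.continuous_parametric_intervalIntegral_of_continuous
      (f := fun z : C(I, ι → ℝ) × ℝ => fun s => G s (xt z.1 s) i) ?_ continuous_snd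
    exact (hint i).comp ((continuous_fst.comp continuous_fst).prodMk continuous_snd)
  have hPc : ∀ x, Continuous (P x) := fun x => hP.comp (continuous_const.prodMk continuous_id)
  let Φ : C(I, ι → ℝ) → C(I, ι → ℝ) := fun x => ⟨fun t => P x t, (hPc x).comp continuous_subtype_val⟩
  have hΦ : Continuous Φ := ContinuousMap.continuous_of_continuous_uncurry _
    (hP.comp (continuous_fst.prodMk (continuous_subtype_val.comp continuous_snd)))
  have hdiff : ∀ x i, ∀ s ∈ Icc 0 T, ∀ t ∈ Icc 0 T,
      |∫ r in s..t, G r (xt x r) i| ≤ L * |t - s| := fun x i s hs t ht => by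
    rw [← Real.norm_eq_abs]
    refine intervalIntegral.norm_integral_le_of_norm_le_const fun r hr => ?_
    have h1 : r ∈ uIcc s t := uIoc_subset_uIcc hr
    exact hL r ((convex_Icc 0 T).ordConnected.uIcc_subset hs ht h1) _ _
  let K : Set C(I, ι → ℝ) := {x | (∀ t, ‖x t‖ ≤ ‖x₀‖ + L * T) ∧
    ∀ s t, dist (x s) (x t) ≤ L * dist s t}
  have hKconv : Convex ℝ K := by
    rintro x ⟨hx1, hx2⟩ y ⟨hy1, hy2⟩ a b ha hb hab
    refine ⟨fun t => ?_, fun s t => ?_⟩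
    · calc ‖a • x t + b • y t‖ ≤ a * ‖x t‖ + b * ‖y t‖ := by
            refine (norm_add_le _ _).trans_eq ?_
            rw [norm_smul, norm_smul, Real.norm_of_nonneg ha, Real.norm_of_nonneg hb]
        _ ≤ a * (‖x₀‖ + L * T) + b * (‖x₀‖ + L * T) := by
            gcongr
            · exact hx1 t
            · exact hy1 t
        _ = ‖x₀‖ + L * T := by rw [← add_mul, hab, one_mul]
    · calc dist (a • x s + b • y s) (a • x t + b • y t)
          ≤ a * dist (x s) (x t) + b * dist (y s) (y t) := by
            refine (dist_add_add_le _ _ _ _).trans_eq ?_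
            rw [dist_smul₀, dist_smul₀, Real.norm_of_nonneg ha, Real.norm_of_nonneg hb]
        _ ≤ a * (L * dist s t) + b * (L * dist s t) := by
            gcongr
            · exact hx2 s t
            · exact hy2 s t
        _ = L * dist s t := by rw [← add_mul, hab, one_mul]
  have hKne : K.Nonempty := by
    refine ⟨0, fun t => ?_, fun s t => ?_⟩
    · rw [ContinuousMap.zero_apply, norm_zero]; positivity
    · rw [ContinuousMap.zero_apply, ContinuousMap.zero_apply, dist_self]; positivity
  have hΦK : MapsTo Φ K K := by
    refine fun x _ => ⟨fun t => ?_, fun s t => ?_⟩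
    · refine (pi_norm_le_iff_of_nonneg (by positivity)).2 fun i => ?_
      refine (norm_add_le _ _).trans (add_le_add (norm_le_pi_norm x₀ i) ?_)
      rw [Real.norm_eq_abs]
      refine (hdiff x i _ (ht₀ i) _ t.2).trans ?_
      have h1 : |(t : ℝ) - t₀ i| ≤ T := by
        rw [abs_le]; constructor <;> linarith [t.2.1, t.2.2, (ht₀ i).1, (ht₀ i).2]
      gcongr
    · refine (dist_pi_le_iff (by positivity)).2 fun i => ?_
      have h1 : P x s i - P x t i = ∫ r in (t : ℝ)..s, G r (xt x r) i := by
        simp only [P]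
        rw [add_sub_add_left_eq_sub, intervalIntegral.integral_interval_sub_left] <;>
          exact (hint' x i).intervalIntegrable _ _
      rw [Real.dist_eq]
      change |P x s i - P x t i| ≤ _
      rw [h1]
      exact hdiff x i t t.2 s s.2
  obtain ⟨x, -, hx⟩ := exists_fixedPoint_of_isCompact_convex
    (isCompact_setOf_norm_le_and_dist_le _ _) hKconv hKne hΦ.continuousOn hΦK
  have hxP : ∀ t ∈ Icc 0 T, xt x t = P x t := fun t ht => by
    simp only [xt]
    conv_lhs => rw [← hx, projIcc_of_mem hT ht]
    rfl
  refine ⟨xt x, hxt.comp (continuous_const.prodMk continuous_id), fun i => ?_, fun t ht i => ?_⟩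
  · rw [hxP _ (ht₀ i)]
    simp [P]
  · have h1 : HasDerivAt (fun s => P x s i) (G t (xt x t) i) t :=
      (intervalIntegral.integral_hasDerivAt_right ((hint' x i).intervalIntegrable _ _)
        ((hint' x i).stronglyMeasurableAtFilter _ _) (hint' x i).continuousAt).const_add _
    exact h1.hasDerivWithinAt.congr (fun s hs => congrFun (hxP s hs) i) (congrFun (hxP t ht) i)

/-- A system of differential equations indexed by a finite set `S`, whose field is evaluated at the
projection of the state on a box, has a solution on `[0, T]` whose components take prescribed values
at prescribed times. -/
theorem exists_solution_multipoint_box {α : Type*} (S : Finset α) {T : ℝ} (hT : 0 ≤ T)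
    (F : ℝ → (α → ℝ) → α → ℝ) (hF : ∀ i, Continuous fun z : ℝ × (α → ℝ) => F z.1 z.2 i)
    (lo hi : α → ℝ) (hlohi : lo ≤ hi) (t₀ : α → ℝ) (ht₀ : ∀ i, t₀ i ∈ Icc 0 T) (x₀ : α → ℝ) :
    ∃ x : ℝ → α → ℝ, Continuous x ∧ (∀ t, ∀ i ∉ S, x t i = 0) ∧ (∀ i ∈ S, x (t₀ i) i = x₀ i) ∧
      ∀ t ∈ Icc 0 T, ∀ i ∈ S,
        HasDerivWithinAt (fun s => x s i) (F t (fun j => max (lo j) (min (hi j) (x t j))) i) (Icc 0 T) t := by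
  classical
  let e : (S → ℝ) → α → ℝ := fun y i => if h : i ∈ S then y ⟨i, h⟩ else 0
  have he : Continuous e := continuous_pi fun i => by
    by_cases h : i ∈ S
    · simpa only [e, h, dite_true] using continuous_apply _
    · simpa only [e, h, dite_false] using continuous_const
  let G : ℝ → (S → ℝ) → S → ℝ := fun t y i => F t (fun j => max (lo j) (min (hi j) (e y j))) i
  have hG : Continuous (Function.uncurry G) := continuous_pi fun i =>
    (hF i).comp (continuous_fst.prodMk
      (continuous_pi fun j => continuous_const.max (continuous_const.min
        ((continuous_apply j).comp (he.comp continuous_snd)))))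
  have hbound : ∀ i, ∃ L, ∀ t ∈ Icc 0 T, ∀ y : α → ℝ, |F t (fun j => max (lo j) (min (hi j) (y j))) i| ≤ L := fun i => by
    -- The index type may be infinite; the box is compact for the product topology, for which the
    -- field is continuous.
    have hc : IsCompact (Icc (0 : ℝ) T ×ˢ (univ.pi fun j => Icc (lo j) (hi j))) :=
      isCompact_Icc.prod (isCompact_univ_pi fun _ => isCompact_Icc)
    obtain ⟨L, hL⟩ := hc.exists_bound_of_continuousOn (hF i).continuousOn
    exact ⟨L, fun t ht (y : α → ℝ) => hL (t, _) ⟨ht, fun j _ =>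
      ⟨le_max_left _ _, max_le (hlohi j) (min_le_left _ _)⟩⟩⟩
  choose L hL using hbound
  obtain ⟨y, hy1, hy2, hy3⟩ := exists_solution_multipoint hT G hG (∑ i : S, |L i|)
    (fun t ht x i => (hL i t ht _).trans ((le_abs_self _).trans
      (Finset.single_le_sum (f := fun i : S => |L i|) (fun j _ => abs_nonneg _)
        (Finset.mem_univ i)))) (fun i => t₀ i) (fun i => ht₀ i) fun i => x₀ i
  have hey : ∀ t, ∀ i, ∀ h : i ∈ S, e (y t) i = y t ⟨i, h⟩ := fun t i h => by
    simp only [e, h, dite_true]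
  refine ⟨fun t => e (y t), he.comp hy1, fun t i h => ?_, fun i h => ?_, fun t ht i h => ?_⟩
  · simp only [e, h, dite_false]
  · exact (hey _ i h).trans (hy2 ⟨i, h⟩)
  · simpa only [hey _ i h] using hy3 t ht ⟨i, h⟩

end MultipointProblem
end

noncomputable section

/-! ### Maximum principles, truncation and feedback maps. -/

section Comparison

variable {T : ℝ}

lemma deriv_nonpos_of_isMaxOn_Icc {f : ℝ → ℝ} {d a b t : ℝ} (ht : t ∈ Ico a b)
    (hd : HasDerivWithinAt f d (Icc a b) t) (hmax : ∀ s ∈ Icc a b, f s ≤ f t) : d ≤ 0 := by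
  have h1 := (hd.mono (Icc_subset_Icc_left ht.1)).mono Ioc_subset_Icc_self
  rw [hasDerivWithinAt_iff_tendsto_slope' (by simp)] at h1
  have : (nhdsWithin t (Ioc t b)).NeBot := by
    rw [nhdsWithin_Ioc_eq_nhdsGT ht.2]; infer_instance
  refine le_of_tendsto h1 ?_
  filter_upwards [self_mem_nhdsWithin] with s hs
  rw [slope_def_field]
  exact div_nonpos_of_nonpos_of_nonneg
    (sub_nonpos.2 (hmax s ⟨ht.1.trans hs.1.le, hs.2⟩)) (sub_nonneg.2 hs.1.le)

/-- Maximum principle for a finite family of functions with a terminal bound. -/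
theorem le_of_deriv_ge_at_argmax {α : Type*} (S : Finset α) {B C : ℝ} (u u' : ℝ → α → ℝ)
    (hd : ∀ t ∈ Icc 0 T, ∀ i ∈ S, HasDerivWithinAt (fun s => u s i) (u' t i) (Icc 0 T) t)
    (hB : ∀ i ∈ S, u T i ≤ B)
    (h : ∀ t ∈ Icc 0 T, ∀ i ∈ S, (∀ j ∈ S, u t j ≤ u t i) → -C ≤ u' t i) :
    ∀ t ∈ Icc 0 T, ∀ i ∈ S, u t i ≤ B + C * (T - t) := by
  intro t₁ ht₁ i₁ hi₁
  have hS : S.Nonempty := ⟨i₁, hi₁⟩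
  refine le_of_forall_pos_le_add fun ε hε => ?_
  have hT1 : 0 ≤ T - t₁ := sub_nonneg.2 ht₁.2
  -- The extra slope `η` makes the inequality at the maximum strict, which excludes a maximum before
  -- `T`; it costs at most `ε` at `t₁`.
  set η := ε / (T - t₁ + 1)
  have hη : 0 < η := by positivity
  have hηε : η * (T - t₁) ≤ ε := by
    rw [div_mul_eq_mul_div, div_le_iff₀ (by positivity)]; nlinarith
  let V : ℝ → ℝ := fun t => S.sup' hS (fun i => u t i) - (C + η) * (T - t)
  have hVc : ContinuousOn V (Icc 0 T) :=
    (ContinuousOn.finset_sup'_apply hS fun i hi t ht => (hd t ht i hi).continuousWithinAt).sub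
      (by fun_prop)
  obtain ⟨t, ht, hmax⟩ := isCompact_Icc.exists_isMaxOn ⟨t₁, ht₁⟩ hVc
  obtain ⟨i, hi, hii⟩ := S.exists_mem_eq_sup' hS fun i => u t i
  have harg : ∀ j ∈ S, u t j ≤ u t i := fun j hj =>
    hii ▸ Finset.le_sup' (fun i => u t i) hj
  have hVt : V t = u t i - (C + η) * (T - t) := by simp only [V, hii]
  have hle : ∀ s ∈ Icc 0 T, ∀ j ∈ S,
      u s j - (C + η) * (T - s) ≤ u t i - (C + η) * (T - t) := fun s hs j hj => by
    rw [← hVt]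
    exact (sub_le_sub_right (Finset.le_sup' (fun i => u s i) hj) _).trans (hmax hs)
  have htT : t = T := by
    by_contra hne
    have h1 : HasDerivWithinAt (fun s => u s i - (C + η) * (T - s))
        (u' t i - (C + η) * (0 - 1)) (Icc 0 T) t :=
      (hd t ht i hi).sub (((hasDerivWithinAt_const _ _ _).sub
        (hasDerivWithinAt_id _ _)).const_mul _)
    have h2 := deriv_nonpos_of_isMaxOn_Icc ⟨ht.1, lt_of_le_of_ne ht.2 hne⟩ h1
      fun s hs => hle s hs i hi
    have h3 := h t ht i hi harg
    linarith
  have h1 := hle t₁ ht₁ i₁ hi₁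
  have h2 := hB i hi
  rw [htT] at h1
  nlinarith

/-- Two-sided version of the maximum principle. -/
theorem abs_le_of_deriv_bounds_at_extrema {α : Type*} (S : Finset α) {C : ℝ} (u u' : ℝ → α → ℝ)
    (hd : ∀ t ∈ Icc 0 T, ∀ i ∈ S, HasDerivWithinAt (fun s => u s i) (u' t i) (Icc 0 T) t)
    (hzero : ∀ i ∈ S, u T i = 0)
    (hmax : ∀ t ∈ Icc 0 T, ∀ i ∈ S, (∀ j ∈ S, u t j ≤ u t i) → -C ≤ u' t i)
    (hmin : ∀ t ∈ Icc 0 T, ∀ i ∈ S, (∀ j ∈ S, u t i ≤ u t j) → u' t i ≤ C) :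
    ∀ t ∈ Icc 0 T, ∀ i ∈ S, |u t i| ≤ C * (T - t) := by
  intro t ht i hi
  have h1 := le_of_deriv_ge_at_argmax S u u' hd (fun i hi => (hzero i hi).le) hmax t ht i hi
  have h2 := le_of_deriv_ge_at_argmax S (fun t i => -u t i) (fun t i => -u' t i)
    (fun t ht i hi => (hd t ht i hi).neg) (B := 0) (C := C)
    (fun i hi => by rw [hzero i hi, neg_zero])
    (fun t ht i hi h => neg_le_neg (hmin t ht i hi fun j hj => neg_le_neg_iff.1 (h j hj))) t ht i hi
  rw [abs_le]
  constructor <;> linarith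

lemma nonneg_of_deriv_nonneg_of_neg {f f' : ℝ → ℝ}
    (hd : ∀ t ∈ Icc 0 T, HasDerivWithinAt f (f' t) (Icc 0 T) t) (h0 : 0 ≤ f 0)
    (h : ∀ t ∈ Icc 0 T, f t < 0 → 0 ≤ f' t) : ∀ t ∈ Icc 0 T, 0 ≤ f t := by
  intro t ht
  refine le_of_forall_pos_le_add fun ε hε => ?_
  have hT1 : 0 ≤ t := ht.1
  set η := ε / (t + 1)
  have hη : 0 < η := by positivity
  -- If `-f` meets the barrier `η (s + 1) > 0`, then `f < 0` there, so the slope of `-f` is at most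
  -- 0 and below `η`.
  have h1 := image_le_of_deriv_right_lt_deriv_boundary (f := fun s => -f s) (f' := fun s => -f' s)
    (a := 0) (b := T) (B := fun s => η * (s + 1)) (B' := fun _ => η * 1)
    (fun s hs => (hd s hs).continuousWithinAt.neg)
    (fun s hs => ((hd s ⟨hs.1, hs.2.le⟩).mono_of_mem_nhdsWithin
      (Icc_mem_nhdsGE_of_mem hs)).neg)
    (by simp only [zero_add, mul_one]; linarith)
    (fun s => ((hasDerivAt_id s).add_const 1).const_mul η)
    (fun s hs hsB => by
      have h2 : f s < 0 := by
        have : 0 < η * (s + 1) := by have := hs.1; positivity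
        linarith
      linarith [h s ⟨hs.1, hs.2.le⟩ h2]) ht
  have h2 : η * (t + 1) = ε := div_mul_cancel₀ _ (by positivity)
  rw [h2] at h1
  linarith

lemma eq_of_hasDerivWithinAt_zero {f : ℝ → ℝ}
    (hd : ∀ t ∈ Icc 0 T, HasDerivWithinAt f 0 (Icc 0 T) t) : ∀ t ∈ Icc 0 T, f t = f 0 := by
  refine constant_of_has_deriv_right_zero (fun t ht => (hd t ht).continuousWithinAt) fun t ht => ?_
  exact (hd t ⟨ht.1, ht.2.le⟩).mono_of_mem_nhdsWithin (Icc_mem_nhdsGE_of_mem ht)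

lemma contDiffOn_one_of_hasDerivWithinAt_Icc (hT : 0 < T) {f f' : ℝ → ℝ}
    (hd : ∀ t ∈ Icc 0 T, HasDerivWithinAt f (f' t) (Icc 0 T) t)
    (hc : ContinuousOn f' (Icc 0 T)) : ContDiffOn ℝ 1 f (Icc 0 T) := by
  have hu := uniqueDiffOn_Icc hT
  rw [show (1 : WithTop ℕ∞) = 0 + 1 from (zero_add 1).symm, contDiffOn_succ_iff_derivWithin hu]
  refine ⟨fun t ht => (hd t ht).differentiableWithinAt, by simp, ?_⟩
  rw [contDiffOn_zero]
  exact hc.congr fun t ht => (hd t ht).derivWithin (hu t ht)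

lemma exists_bound_of_continuous {α : Type*} (S : Finset α) (u : ℝ → α → ℝ)
    (hu : ∀ i ∈ S, Continuous fun t => u t i) :
    ∃ C, ∀ t ∈ Icc 0 T, ∀ i ∈ S, |u t i| ≤ C := by
  have h1 : ContinuousOn (fun t => ∑ i ∈ S, |u t i|) (Icc 0 T) :=
    (continuous_finsetSum _ fun i hi => (hu i hi).abs).continuousOn
  obtain ⟨C, hC⟩ := isCompact_Icc.exists_bound_of_continuousOn h1
  exact ⟨C, fun t ht i hi =>
    (Finset.single_le_sum (f := fun i => |u t i|) (fun j _ => abs_nonneg _) hi).trans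
      ((le_abs_self _).trans (hC t ht))⟩

/-- Truncation is monotone and 1-Lipschitz. One-sided bounds at an extremum of the untruncated
function therefore pass to the truncated one that enters the equations. -/
lemma clamp_sub_clamp_ge {R c r s : ℝ} (hc : 0 ≤ c) (h : -c ≤ r - s) :
    -c ≤ max (-R) (min R r) - max (-R) (min R s) := by
  rcases max_cases (-R) (min R r) with h1 | h1 <;> rcases max_cases (-R) (min R s) with h2 | h2 <;>
    rcases min_cases R r with h3 | h3 <;> rcases min_cases R s with h4 | h4 <;> linarith

lemma clamp_eq_self {R r : ℝ} (h : |r| ≤ R) : max (-R) (min R r) = r := by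
  rw [abs_le] at h
  rw [min_eq_right h.2, max_eq_right h.1]

end Comparison

/-- What the equations need from a feedback map for an intensity `exp (-a x)`: continuity and
one-sided bounds of the Hamiltonian at the feedback quote. -/
structure IsFeedback (a : ℝ) (f : ℝ → ℝ) : Prop where
  continuous : Continuous f
  bound : ∀ c, 0 ≤ c → ∃ K, 0 ≤ K ∧ ∀ x, (-c ≤ x → Real.exp (-a * f x) * (f x - x) ≤ K) ∧
    (x ≤ c → -K ≤ Real.exp (-a * f x) * (f x - x))

/-- Here `f x - x` is the positive constant `e`: the lower bound is trivial, and the upper one only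
needs `x` bounded below. -/
lemma isFeedback_add {a e : ℝ} (ha : 0 < a) (he : 0 < e) : IsFeedback a fun x => e + x := by
  refine ⟨by fun_prop, fun c _ => ⟨Real.exp (a * c) * e, by positivity, fun x => ⟨fun hx => ?_,
    fun _ => ?_⟩⟩⟩
  · rw [add_sub_cancel_right]
    exact mul_le_mul_of_nonneg_right (Real.exp_le_exp.2 (by nlinarith)) he.le
  · rw [add_sub_cancel_right]
    have h1 : 0 ≤ Real.exp (-a * (e + x)) * e := by positivity
    have h2 : 0 ≤ Real.exp (a * c) * e := by positivity
    linarith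

/-- The quote stays in `[-δ, δ]`, so the exponential is at most `exp (a δ)`, whatever `g` is. -/
lemma isFeedback_clamp {a δ : ℝ} (ha : 0 < a) (hδ : 0 < δ) {g : ℝ → ℝ} (hg : Continuous g) :
    IsFeedback a fun x => MarketModel.clamp δ (g x) := by
  refine ⟨by unfold MarketModel.clamp; fun_prop, fun c hc => ⟨Real.exp (a * δ) * (δ + c),
    by positivity, fun x => ?_⟩⟩
  have h1 : -δ ≤ MarketModel.clamp δ (g x) := le_max_left _ _
  have h2 : MarketModel.clamp δ (g x) ≤ δ := max_le (by linarith) (min_le_left _ _)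
  set d := MarketModel.clamp δ (g x)
  have h3 : Real.exp (-a * d) ≤ Real.exp (a * δ) := Real.exp_le_exp.2 (by nlinarith)
  have h4 : 0 < Real.exp (-a * d) := Real.exp_pos _
  constructor
  · intro hx
    calc Real.exp (-a * d) * (d - x) ≤ Real.exp (-a * d) * (δ + c) := by gcongr; linarith
      _ ≤ _ := by gcongr
  · intro hx
    have h5 : Real.exp (-a * d) * (δ + c) ≤ Real.exp (a * δ) * (δ + c) := by gcongr
    have h6 : Real.exp (-a * d) * (-(δ + c)) ≤ Real.exp (-a * d) * (d - x) := by
      gcongr; linarith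
    linarith

end

noncomputable section

/-! ### Fokker–Planck identities and Hamiltonian estimates. -/

namespace MarketModel

variable (M : MarketModel)

lemma mem_gridQ {q : ℤ} : q ∈ M.gridQ ↔ -M.qMax ≤ q ∧ q ≤ M.qMax := Finset.mem_Icc

lemma mem_gridQm {q : ℤ} : q ∈ M.gridQm ↔ -M.qmMax ≤ q ∧ q ≤ M.qmMax := Finset.mem_Icc

lemma mem_gridB {b : ℤ} : b ∈ M.gridB ↔ -M.bMax ≤ b ∧ b ≤ M.bMax := Finset.mem_Icc

lemma sum_Icc_shift_left (N : ℤ) (h : ℤ → ℝ) :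
    ∑ q ∈ Finset.Icc (-N) N, (if -N < q then 1 else 0) * h (q - 1) =
      ∑ q ∈ Finset.Icc (-N) N, (if q < N then 1 else 0) * h q := by
  simp only [ite_mul, one_mul, zero_mul]
  rw [← Finset.sum_filter, ← Finset.sum_filter]
  refine Finset.sum_nbij' (fun q => q - 1) (fun q => q + 1) ?_ ?_ ?_ ?_ fun q _ => rfl
  · intro q hq
    simp only [Finset.mem_filter, Finset.mem_Icc] at hq ⊢
    omega
  · intro q hq
    simp only [Finset.mem_filter, Finset.mem_Icc] at hq ⊢
    omega
  · intro q _; ring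
  · intro q _; ring

lemma sum_Icc_shift_right (N : ℤ) (h : ℤ → ℝ) :
    ∑ q ∈ Finset.Icc (-N) N, (if q < N then 1 else 0) * h (q + 1) =
      ∑ q ∈ Finset.Icc (-N) N, (if -N < q then 1 else 0) * h q := by
  rw [← sum_Icc_shift_left N fun q => h (q + 1)]
  simp only [sub_add_cancel]

/-- Weak form of the Fokker–Planck operator, for test functions of the inventory. -/
lemma sum_mul_fokkerPlanck (δb δa π : ℤ → ℤ → ℝ) (ψ : ℤ → ℝ) :
    ∑ q ∈ M.gridQm, ∑ b ∈ M.gridB, ψ q * M.fokkerPlanck δb δa π q b =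
      -M.integ (fun y z =>
        (if y < M.qmMax then 1 else 0) * M.Lamm (δb y z) * (ψ (y + 1) - ψ y)
          + (if -M.qmMax < y then 1 else 0) * M.Lamm (δa y z) * (ψ (y - 1) - ψ y)) π := by
  -- Shifting the index turns the inflow from a neighbour into an outflow. The unsimplified argument
  -- `q - 1 + 1` matches the shift lemma; the signal terms cancel because `ψ` ignores the signal.
  have e1 : ∑ q ∈ M.gridQm, ∑ b ∈ M.gridB,
        (if -M.qmMax < q then 1 else 0) * (ψ (q - 1 + 1) * M.Lamm (δb (q - 1) b) * π (q - 1) b) =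
      ∑ q ∈ M.gridQm, ∑ b ∈ M.gridB,
        (if q < M.qmMax then 1 else 0) * (ψ (q + 1) * M.Lamm (δb q b) * π q b) := by
    rw [Finset.sum_comm, Finset.sum_comm (s := M.gridQm)]
    exact Finset.sum_congr rfl fun b _ =>
      sum_Icc_shift_left M.qmMax fun q => ψ (q + 1) * M.Lamm (δb q b) * π q b
  have e2 : ∑ q ∈ M.gridQm, ∑ b ∈ M.gridB,
        (if q < M.qmMax then 1 else 0) * (ψ (q + 1 - 1) * M.Lamm (δa (q + 1) b) * π (q + 1) b) =
      ∑ q ∈ M.gridQm, ∑ b ∈ M.gridB,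
        (if -M.qmMax < q then 1 else 0) * (ψ (q - 1) * M.Lamm (δa q b) * π q b) := by
    rw [Finset.sum_comm, Finset.sum_comm (s := M.gridQm)]
    exact Finset.sum_congr rfl fun b _ =>
      sum_Icc_shift_right M.qmMax fun q => ψ (q - 1) * M.Lamm (δa q b) * π q b
  have e3 : ∑ q ∈ M.gridQm, ∑ b ∈ M.gridB,
        (if -M.bMax < b then 1 else 0) * (M.lamPlus * ψ q * π q (b - 1)) =
      ∑ q ∈ M.gridQm, ∑ b ∈ M.gridB,
        (if b < M.bMax then 1 else 0) * (M.lamPlus * ψ q * π q b) :=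
    Finset.sum_congr rfl fun q _ =>
      sum_Icc_shift_left M.bMax fun b => M.lamPlus * ψ q * π q b
  have e4 : ∑ q ∈ M.gridQm, ∑ b ∈ M.gridB,
        (if b < M.bMax then 1 else 0) * (M.lamMinus * ψ q * π q (b + 1)) =
      ∑ q ∈ M.gridQm, ∑ b ∈ M.gridB,
        (if -M.bMax < b then 1 else 0) * (M.lamMinus * ψ q * π q b) :=
    Finset.sum_congr rfl fun q _ =>
      sum_Icc_shift_right M.bMax fun b => M.lamMinus * ψ q * π q b
  rw [← sub_eq_zero] at e1 e2 e3 e4 ⊢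
  have e5 := congrArg₂ (· + ·) (congrArg₂ (· + ·) e1 e2) (congrArg₂ (· + ·) e3 e4)
  simp only [add_zero] at e5
  refine neg_eq_zero.1 (Eq.trans ?_ e5)
  simp only [integ, fokkerPlanck, ← Finset.sum_add_distrib, ← Finset.sum_sub_distrib,
    ← Finset.sum_neg_distrib]
  refine Finset.sum_congr rfl fun q _ => Finset.sum_congr rfl fun b _ => ?_
  rw [sub_add_cancel, add_sub_cancel_right]
  ring

lemma sum_fokkerPlanck (δb δa π : ℤ → ℤ → ℝ) :
    ∑ q ∈ M.gridQm, ∑ b ∈ M.gridB, M.fokkerPlanck δb δa π q b = 0 := by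
  simpa [integ] using M.sum_mul_fokkerPlanck δb δa π fun _ => 1

/-- The test function `q` changes by `±1` at each trade, which produces the net rate. Along the
flow, the impact is thus an exact time derivative. -/
lemma sum_inventory_mul_fokkerPlanck (δb δa π : ℤ → ℤ → ℝ) :
    M.κ * ∑ q ∈ M.gridQm, ∑ b ∈ M.gridB, (q : ℝ) * M.fokkerPlanck δb δa π q b =
      -M.impact δb δa π := by
  rw [M.sum_mul_fokkerPlanck δb δa π fun q => (q : ℝ), impact, mul_neg]
  congr 3
  funext y z
  simp only [netRate, Int.cast_add, Int.cast_sub, Int.cast_one]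
  ring

lemma Lamm_pos (x : ℝ) : 0 < M.Lamm x := mul_pos M.Am_pos (Real.exp_pos _)

/-- Where the mass vanishes there is no outflow, only inflow; this preserves positivity. -/
lemma fokkerPlanck_nonpos {δb δa π : ℤ → ℤ → ℝ} (hπ : ∀ q b, 0 ≤ π q b) {q b : ℤ}
    (h0 : π q b = 0) : M.fokkerPlanck δb δa π q b ≤ 0 := by
  have hi : ∀ (P : Prop) [Decidable P], (0 : ℝ) ≤ if P then 1 else 0 := fun P _ => by
    split_ifs <;> norm_num
  have h1 : 0 ≤ (if -M.qmMax < q then 1 else 0) * M.Lamm (δb (q - 1) b) * π (q - 1) b :=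
    mul_nonneg (mul_nonneg (hi _) (M.Lamm_pos _).le) (hπ _ _)
  have h2 : 0 ≤ (if q < M.qmMax then 1 else 0) * M.Lamm (δa (q + 1) b) * π (q + 1) b :=
    mul_nonneg (mul_nonneg (hi _) (M.Lamm_pos _).le) (hπ _ _)
  have h3 : 0 ≤ M.lamPlus * (if -M.bMax < b then 1 else 0) * π q (b - 1) :=
    mul_nonneg (mul_nonneg M.lamPlus_pos.le (hi _)) (hπ _ _)
  have h4 : 0 ≤ M.lamMinus * (if b < M.bMax then 1 else 0) * π q (b + 1) :=
    mul_nonneg (mul_nonneg M.lamMinus_pos.le (hi _)) (hπ _ _)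
  rw [fokkerPlanck, h0, mul_zero]
  linarith

lemma genSignal_nonpos {b : ℤ} {z z₁ z₂ : ℝ} (h1 : b < M.bMax → z₁ ≤ z)
    (h2 : -M.bMax < b → z₂ ≤ z) : M.genSignal b z z₁ z₂ ≤ 0 := by
  have hp := M.lamPlus_pos
  have hm := M.lamMinus_pos
  unfold genSignal
  refine add_nonpos ?_ ?_
  · split_ifs with h
    · nlinarith [h1 h]
    · simp
  · split_ifs with h
    · nlinarith [h2 h]
    · simp

lemma genSignal_neg (b : ℤ) (z z₁ z₂ : ℝ) :
    M.genSignal b (-z) (-z₁) (-z₂) = -M.genSignal b z z₁ z₂ := by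
  unfold genSignal; ring

lemma genSignal_nonneg {b : ℤ} {z z₁ z₂ : ℝ} (h1 : b < M.bMax → z ≤ z₁)
    (h2 : -M.bMax < b → z ≤ z₂) : 0 ≤ M.genSignal b z z₁ z₂ := by
  have := M.genSignal_nonpos (b := b) (fun h => neg_le_neg (h1 h)) (fun h => neg_le_neg (h2 h))
  rw [genSignal_neg] at this
  linarith

lemma Lamm_mul_gain (fm : ℝ → ℝ) (z z' : ℝ) :
    M.Lamm (fm (z - z')) * gain (fm (z - z')) z z' =
      M.Am * (Real.exp (-(M.km / M.σ) * fm (z - z')) * (fm (z - z') - (z - z'))) := by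
  unfold Lamm gain; ring

/-- Meant for a maximum over the grid, where neighbours exceed the value by at most `c`; a missing
neighbour is removed by its indicator. -/
lemma hamTaker_le {fm : ℝ → ℝ} {c K : ℝ} (hK : 0 ≤ K)
    (h : ∀ x, -c ≤ x → Real.exp (-(M.km / M.σ) * fm x) * (fm x - x) ≤ K) {q : ℤ} {z z₁ z₂ : ℝ}
    (h1 : q < M.qmMax → -c ≤ z - z₁) (h2 : -M.qmMax < q → -c ≤ z - z₂) :
    M.hamTaker q (fm (z - z₁)) (fm (z - z₂)) z z₁ z₂ ≤ 2 * M.Am * K := by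
  have hA := M.Am_pos
  have hAK : 0 ≤ M.Am * K := by positivity
  have key : ∀ (P : Prop) [Decidable P] (z' : ℝ), (P → -c ≤ z - z') →
      (if P then 1 else 0) * M.Lamm (fm (z - z')) * gain (fm (z - z')) z z' ≤ M.Am * K := by
    intro P _ z' hP
    rw [mul_assoc, Lamm_mul_gain]
    split_ifs with hp
    · rw [one_mul]
      exact mul_le_mul_of_nonneg_left (h _ (hP hp)) hA.le
    · simpa using hAK
  have := add_le_add (key _ z₁ h1) (key _ z₂ h2)
  unfold hamTaker
  linarith

lemma le_hamTaker {fm : ℝ → ℝ} {c K : ℝ} (hK : 0 ≤ K)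
    (h : ∀ x, x ≤ c → -K ≤ Real.exp (-(M.km / M.σ) * fm x) * (fm x - x)) {q : ℤ} {z z₁ z₂ : ℝ}
    (h1 : q < M.qmMax → z - z₁ ≤ c) (h2 : -M.qmMax < q → z - z₂ ≤ c) :
    -(2 * M.Am * K) ≤ M.hamTaker q (fm (z - z₁)) (fm (z - z₂)) z z₁ z₂ := by
  have hA := M.Am_pos
  have hAK : 0 ≤ M.Am * K := by positivity
  have key : ∀ (P : Prop) [Decidable P] (z' : ℝ), (P → z - z' ≤ c) →
      -(M.Am * K) ≤ (if P then 1 else 0) * M.Lamm (fm (z - z')) * gain (fm (z - z')) z z' := by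
    intro P _ z' hP
    rw [mul_assoc, Lamm_mul_gain]
    split_ifs with hp
    · rw [one_mul, ← mul_neg]
      exact mul_le_mul_of_nonneg_left (h _ (hP hp)) hA.le
    · simpa using hAK
  have := add_le_add (key _ z₁ h1) (key _ z₂ h2)
  unfold hamTaker
  linarith

/-- Time derivative of the value function of the market-taker, as prescribed by his
Hamilton–Jacobi–Bellman equation. -/
def takerField (fm : ℝ → ℝ) (w π : ℤ → ℤ → ℝ) (q b : ℤ) : ℝ :=
  M.γ * M.σ ^ 2 * (q : ℝ) ^ 2 - (b : ℝ) * q - M.genSignal b (w q b) (w q (b + 1)) (w q (b - 1))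
    - q * M.impact (takerBid fm w) (takerAsk fm w) π
    - M.hamTaker q (fm (w q b - w (q + 1) b)) (fm (w q b - w (q - 1) b))
        (w q b) (w (q + 1) b) (w (q - 1) b)

variable {M} in
lemma IsPMF.abs_mean_le {π : ℤ → ℤ → ℝ} (hπ : M.IsPMF π) :
    |∑ q ∈ M.gridQm, ∑ b ∈ M.gridB, (q : ℝ) * π q b| ≤ M.qmMax := by
  calc |∑ q ∈ M.gridQm, ∑ b ∈ M.gridB, (q : ℝ) * π q b|
      ≤ ∑ q ∈ M.gridQm, ∑ b ∈ M.gridB, (M.qmMax : ℝ) * π q b := by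
        refine (Finset.abs_sum_le_sum_abs _ _).trans (Finset.sum_le_sum fun q hq =>
          (Finset.abs_sum_le_sum_abs _ _).trans (Finset.sum_le_sum fun b hb => ?_))
        rw [abs_mul, abs_of_nonneg (hπ.1 q hq b hb)]
        refine mul_le_mul_of_nonneg_right ?_ (hπ.1 q hq b hb)
        rw [mem_gridQm] at hq
        exact abs_le.2 ⟨by exact_mod_cast hq.1, by exact_mod_cast hq.2⟩
    _ = M.qmMax := by simp_rw [← Finset.mul_sum]; rw [hπ.2, mul_one]

variable {M} in
lemma IsPMF.le_one {π : ℤ → ℤ → ℝ} (hπ : M.IsPMF π) {q b : ℤ} (hq : q ∈ M.gridQm)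
    (hb : b ∈ M.gridB) : π q b ≤ 1 := by
  rw [← hπ.2]
  exact (Finset.single_le_sum (f := fun b => π q b) (fun b hb => hπ.1 q hq b hb) hb).trans
    (Finset.single_le_sum (f := fun q => ∑ b ∈ M.gridB, π q b)
      (fun q hq => Finset.sum_nonneg fun b hb => hπ.1 q hq b hb) hq)

section Continuity

variable {M} {X : Type*} [TopologicalSpace X] {w π : X → ℤ → ℤ → ℝ} {fm : ℝ → ℝ}

lemma continuous_impact (hfm : Continuous fm) (hw : ∀ q b, Continuous fun x => w x q b)
    (hπ : ∀ q b, Continuous fun x => π x q b) :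
    Continuous fun x => M.impact (takerBid fm (w x)) (takerAsk fm (w x)) (π x) := by
  unfold impact integ netRate takerBid takerAsk Lamm
  fun_prop

lemma continuous_takerField (hfm : Continuous fm) (hw : ∀ q b, Continuous fun x => w x q b)
    (hπ : ∀ q b, Continuous fun x => π x q b) (q b : ℤ) :
    Continuous fun x => M.takerField fm (w x) (π x) q b := by
  have h := continuous_impact (M := M) hfm hw hπ
  unfold takerField genSignal hamTaker Lamm gain
  fun_prop

lemma continuous_fokkerPlanck (hfm : Continuous fm) (hw : ∀ q b, Continuous fun x => w x q b)
    (hπ : ∀ q b, Continuous fun x => π x q b) (q b : ℤ) :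
    Continuous fun x => M.fokkerPlanck (takerBid fm (w x)) (takerAsk fm (w x)) (π x) q b := by
  unfold fokkerPlanck takerBid takerAsk Lamm
  fun_prop

end Continuity

end MarketModel
end

noncomputable section

/-! ### The coupled system of the market-takers. -/

namespace MarketModel

variable (M : MarketModel)

/-- The coupled system of the market-takers has a solution, if the value function is truncated
at the level `R` in the equations. -/
lemma exists_truncated_taker_solution {fm : ℝ → ℝ} (hfm : Continuous fm) {P₀ : ℤ → ℤ → ℝ}
    (hP₀ : M.IsPMF P₀) {R : ℝ} (hR : 0 ≤ R) :
    ∃ w p : ℝ → ℤ → ℤ → ℝ, (∀ q b, Continuous fun t => w t q b) ∧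
      (∀ q b, Continuous fun t => p t q b) ∧ (∀ t ∈ Icc 0 M.T, M.IsPMF (p t)) ∧
      (∀ t q b, ¬(q ∈ M.gridQm ∧ b ∈ M.gridB) → w t q b = 0) ∧
      ∀ q ∈ M.gridQm, ∀ b ∈ M.gridB, p 0 q b = P₀ q b ∧ w M.T q b = 0 ∧ ∀ t ∈ Icc 0 M.T,
        HasDerivWithinAt (fun s => w s q b)
          (M.takerField fm (fun q b => max (-R) (min R (w t q b))) (p t) q b) (Icc 0 M.T) t ∧
        HasDerivWithinAt (fun s => p s q b)
          (-M.fokkerPlanck (takerBid fm fun q b => max (-R) (min R (w t q b)))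
            (takerAsk fm fun q b => max (-R) (min R (w t q b))) (p t) q b) (Icc 0 M.T) t := by
  -- The left summand carries the value function, prescribed at `T` and truncated to `[-R, R]`; the
  -- right one carries the law, prescribed at 0 and truncated to `[0, 1]`.
  let S : Finset ((ℤ × ℤ) ⊕ (ℤ × ℤ)) := (M.gridQm ×ˢ M.gridB).disjSum (M.gridQm ×ˢ M.gridB)
  let ω : ((ℤ × ℤ) ⊕ (ℤ × ℤ) → ℝ) → ℤ → ℤ → ℝ := fun x q b => x (Sum.inl (q, b))
  let π : ((ℤ × ℤ) ⊕ (ℤ × ℤ) → ℝ) → ℤ → ℤ → ℝ := fun x q b => x (Sum.inr (q, b))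
  let F : ℝ → ((ℤ × ℤ) ⊕ (ℤ × ℤ) → ℝ) → (ℤ × ℤ) ⊕ (ℤ × ℤ) → ℝ := fun _ x =>
    Sum.elim (fun z => M.takerField fm (ω x) (π x) z.1 z.2)
      fun z => -M.fokkerPlanck (takerBid fm (ω x)) (takerAsk fm (ω x)) (π x) z.1 z.2
  have hω : ∀ q b, Continuous fun z : ℝ × ((ℤ × ℤ) ⊕ (ℤ × ℤ) → ℝ) => ω z.2 q b := fun q b =>
    (continuous_apply _).comp continuous_snd
  have hπ : ∀ q b, Continuous fun z : ℝ × ((ℤ × ℤ) ⊕ (ℤ × ℤ) → ℝ) => π z.2 q b := fun q b =>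
    (continuous_apply _).comp continuous_snd
  have hF : ∀ i, Continuous fun z : ℝ × ((ℤ × ℤ) ⊕ (ℤ × ℤ) → ℝ) => F z.1 z.2 i := by
    rintro (⟨q, b⟩ | ⟨q, b⟩)
    · exact continuous_takerField hfm hω hπ q b
    · exact (continuous_fokkerPlanck hfm hω hπ q b).neg
  obtain ⟨x, hx, hxS, hx0, hxd⟩ := exists_solution_multipoint_box S M.T_pos.le F hF
    (Sum.elim (fun _ => -R) fun _ => 0) (Sum.elim (fun _ => R) fun _ => 1)
    (by rintro (_ | _) <;> simp [hR]) (Sum.elim (fun _ => M.T) fun _ => 0)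
    (by rintro (_ | _) <;> simp [M.T_pos.le]) (Sum.elim (fun _ => 0) fun z => P₀ z.1 z.2)
  let w : ℝ → ℤ → ℤ → ℝ := fun t => ω (x t)
  let p : ℝ → ℤ → ℤ → ℝ := fun t => π (x t)
  let χ : ℝ → ℤ → ℤ → ℝ := fun t q b => max (-R) (min R (w t q b))
  let ρ : ℝ → ℤ → ℤ → ℝ := fun t q b => max 0 (min 1 (p t q b))
  have hSl : ∀ {q b}, q ∈ M.gridQm → b ∈ M.gridB → Sum.inl (q, b) ∈ S := fun hq hb =>
    Finset.inl_mem_disjSum.2 (Finset.mk_mem_product hq hb)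
  have hSr : ∀ {q b}, q ∈ M.gridQm → b ∈ M.gridB → Sum.inr (q, b) ∈ S := fun hq hb =>
    Finset.inr_mem_disjSum.2 (Finset.mk_mem_product hq hb)
  have hwd : ∀ q ∈ M.gridQm, ∀ b ∈ M.gridB, ∀ t ∈ Icc 0 M.T,
      HasDerivWithinAt (fun s => w s q b) (M.takerField fm (χ t) (ρ t) q b) (Icc 0 M.T) t :=
    fun q hq b hb t ht => hxd t ht _ (hSl hq hb)
  have hpd : ∀ q ∈ M.gridQm, ∀ b ∈ M.gridB, ∀ t ∈ Icc 0 M.T, HasDerivWithinAt (fun s => p s q b)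
      (-M.fokkerPlanck (takerBid fm (χ t)) (takerAsk fm (χ t)) (ρ t) q b) (Icc 0 M.T) t :=
    fun q hq b hb t ht => hxd t ht _ (hSr hq hb)
  have hp0 : ∀ q ∈ M.gridQm, ∀ b ∈ M.gridB, p 0 q b = P₀ q b := fun q hq b hb =>
    hx0 _ (hSr hq hb)
  have hρ : ∀ t q b, 0 ≤ ρ t q b := fun t q b => le_max_left _ _
  have hpmf : ∀ t ∈ Icc 0 M.T, M.IsPMF (p t) := by
    refine fun t ht => ⟨fun q hq b hb => ?_, ?_⟩
    · refine nonneg_of_deriv_nonneg_of_neg (hpd q hq b hb) ?_ (fun s hs hneg => ?_) t ht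
      · rw [hp0 q hq b hb]; exact hP₀.1 q hq b hb
      -- Where `p` is negative its truncation is 0, so only inflow is left.
      · exact neg_nonneg.2 (M.fokkerPlanck_nonpos (hρ s)
          (max_eq_left ((min_le_right _ _).trans hneg.le)))
    -- The operator sums to zero on any argument, so the truncation of `p` does not affect the
    -- conservation of mass.
    · have h1 : ∀ s ∈ Icc 0 M.T, HasDerivWithinAt
          (fun s => ∑ q ∈ M.gridQm, ∑ b ∈ M.gridB, p s q b) 0 (Icc 0 M.T) s := fun s hs => by
        have h2 := HasDerivWithinAt.fun_sum fun q (hq : q ∈ M.gridQm) =>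
          HasDerivWithinAt.fun_sum fun b (hb : b ∈ M.gridB) => hpd q hq b hb s hs
        simpa only [Finset.sum_neg_distrib, sum_fokkerPlanck, neg_zero] using h2
      rw [eq_of_hasDerivWithinAt_zero h1 t ht, ← hP₀.2]
      exact Finset.sum_congr rfl fun q hq => Finset.sum_congr rfl fun b hb => hp0 q hq b hb
  have hρp : ∀ t ∈ Icc 0 M.T, ρ t = p t := fun t ht => by
    funext q b
    by_cases h : q ∈ M.gridQm ∧ b ∈ M.gridB
    · have h1 := (hpmf t ht).1 q h.1 b h.2
      simp only [ρ, min_eq_right ((hpmf t ht).le_one h.1 h.2), max_eq_right h1]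
    · have h1 : p t q b = 0 := hxS t _ fun h2 =>
        h (Finset.mem_product.1 (Finset.inr_mem_disjSum.1 h2))
      simp [ρ, h1]
  refine ⟨w, p, fun q b => (continuous_apply _).comp hx, fun q b => (continuous_apply _).comp hx,
    hpmf, fun t q b h => hxS t _ fun h2 => h (Finset.mem_product.1 (Finset.inl_mem_disjSum.1 h2)),
    fun q hq b hb => ⟨hp0 q hq b hb, hx0 _ (hSl hq hb), fun t ht => ?_⟩⟩
  have h1 := hwd q hq b hb t ht
  have h2 := hpd q hq b hb t ht
  rw [hρp t ht] at h1 h2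
  exact ⟨h1, h2⟩

/-- The coupled system of the market-takers, which does not involve the market-maker, has a
solution. The permanent impact is `κ` times the derivative of the mean inventory, so the value
function minus its impact part satisfies a bound which does not depend on the truncation. -/
theorem exists_taker_solution {fm : ℝ → ℝ} (hfm : IsFeedback (M.km / M.σ) fm) {P₀ : ℤ → ℤ → ℝ}
    (hP₀ : M.IsPMF P₀) :
    ∃ w p : ℝ → ℤ → ℤ → ℝ, (∀ q b, Continuous fun t => w t q b) ∧
      (∀ q b, Continuous fun t => p t q b) ∧ (∀ t ∈ Icc 0 M.T, M.IsPMF (p t)) ∧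
      ∀ q ∈ M.gridQm, ∀ b ∈ M.gridB, p 0 q b = P₀ q b ∧ w M.T q b = 0 ∧ ∀ t ∈ Icc 0 M.T,
        HasDerivWithinAt (fun s => w s q b) (M.takerField fm (w t) (p t) q b) (Icc 0 M.T) t ∧
        HasDerivWithinAt (fun s => p s q b)
          (-M.fokkerPlanck (takerBid fm (w t)) (takerAsk fm (w t)) (p t) q b) (Icc 0 M.T) t := by
  have hκ := M.κ_pos
  have hγ := M.γ_pos
  have hA := M.Am_pos
  have hT := M.T_pos
  have hN : (0 : ℝ) < M.qmMax := by exact_mod_cast M.qmMax_pos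
  have hB : (0 : ℝ) < M.bMax := by exact_mod_cast M.bMax_pos
  -- The mean inventory lies in `[-qmMax, qmMax]`, so `c` bounds the impact accumulated between any
  -- time and `T`. The constant `C` below does not depend on `R`.
  set c : ℝ := M.κ * (2 * M.qmMax)
  have hc : 0 ≤ c := by positivity
  obtain ⟨K, hK0, hK⟩ := hfm.bound c hc
  set C : ℝ := M.γ * M.σ ^ 2 * (M.qmMax : ℝ) ^ 2 + M.bMax * M.qmMax + 2 * M.Am * K
  have hC : 0 ≤ C := by positivity
  set R : ℝ := C * M.T + c * M.qmMax
  have hR : 0 ≤ R := by positivity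
  obtain ⟨w, p, hw, hp, hpmf, hw0, hwp⟩ := M.exists_truncated_taker_solution hfm.continuous hP₀ hR
  set χ : ℝ → ℤ → ℤ → ℝ := fun t q b => max (-R) (min R (w t q b))
  let I : ℝ → ℝ := fun t => M.impact (takerBid fm (χ t)) (takerAsk fm (χ t)) (p t)
  let m : ℝ → ℝ := fun t => ∑ q ∈ M.gridQm, ∑ b ∈ M.gridB, (q : ℝ) * p t q b
  have hm : ∀ t ∈ Icc 0 M.T, HasDerivWithinAt (fun s => M.κ * m s) (I t) (Icc 0 M.T) t := by
    intro t ht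
    have h1 := (HasDerivWithinAt.fun_sum fun q (hq : q ∈ M.gridQm) =>
      HasDerivWithinAt.fun_sum fun b (hb : b ∈ M.gridB) =>
        ((hwp q hq b hb).2.2 t ht).2.const_mul (q : ℝ)).const_mul M.κ
    simp only [mul_neg, Finset.sum_neg_distrib] at h1
    rwa [M.sum_inventory_mul_fokkerPlanck, neg_neg] at h1
  -- Normalised to vanish at `T`, so that `U` keeps the zero terminal value.
  let n : ℝ → ℝ := fun t => M.κ * m t - M.κ * m M.T
  have hn : ∀ t ∈ Icc 0 M.T, |n t| ≤ c := fun t ht => by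
    have h1 := abs_le.1 (hpmf t ht).abs_mean_le
    have h2 := abs_le.1 (hpmf M.T ⟨hT.le, le_rfl⟩).abs_mean_le
    simp only [n, ← mul_sub]
    rw [abs_mul, abs_of_pos hκ]
    refine mul_le_mul_of_nonneg_left (abs_le.2 ⟨?_, ?_⟩) hκ.le <;> linarith [h1.1, h1.2, h2.1, h2.2]
  have hqm : ∀ q ∈ M.gridQm, |(q : ℝ)| ≤ M.qmMax := fun q hq => by
    rw [mem_gridQm] at hq
    exact abs_le.2 ⟨by exact_mod_cast hq.1, by exact_mod_cast hq.2⟩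
  have hbm : ∀ b ∈ M.gridB, |(b : ℝ)| ≤ M.bMax := fun b hb => by
    rw [mem_gridB] at hb
    exact abs_le.2 ⟨by exact_mod_cast hb.1, by exact_mod_cast hb.2⟩
  have hbq : ∀ q ∈ M.gridQm, ∀ b ∈ M.gridB, |(b : ℝ) * q| ≤ M.bMax * M.qmMax :=
    fun q hq b hb => by
      rw [abs_mul]
      exact mul_le_mul (hbm b hb) (hqm q hq) (abs_nonneg _) hB.le
  have hq2 : ∀ q ∈ M.gridQm, M.γ * M.σ ^ 2 * (q : ℝ) ^ 2 ≤ M.γ * M.σ ^ 2 * (M.qmMax : ℝ) ^ 2 :=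
    fun q hq => mul_le_mul_of_nonneg_left (sq_le_sq' (abs_le.1 (hqm q hq)).1
      (abs_le.1 (hqm q hq)).2) (by positivity)
  have hχ : ∀ t q b q' b', ∀ e, 0 ≤ e → -e ≤ w t q b - w t q' b' → -e ≤ χ t q b - χ t q' b' :=
    fun t q b q' b' e he h => clamp_sub_clamp_ge he h
  let U : ℝ → ℤ × ℤ → ℝ := fun t z => w t z.1 z.2 + z.1 * n t
  let U' : ℝ → ℤ × ℤ → ℝ := fun t z => M.takerField fm (χ t) (p t) z.1 z.2 + z.1 * I t
  have hU' : ∀ t q b, U' t (q, b) = M.γ * M.σ ^ 2 * (q : ℝ) ^ 2 - (b : ℝ) * q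
      - M.genSignal b (χ t q b) (χ t q (b + 1)) (χ t q (b - 1))
      - M.hamTaker q (fm (χ t q b - χ t (q + 1) b)) (fm (χ t q b - χ t (q - 1) b))
        (χ t q b) (χ t (q + 1) b) (χ t (q - 1) b) := fun t q b => by
    simp only [U', takerField, I]; ring
  have hUb : ∀ t ∈ Icc 0 M.T, ∀ z ∈ M.gridQm ×ˢ M.gridB, |U t z| ≤ C * (M.T - t) := by
    refine abs_le_of_deriv_bounds_at_extrema _ U U' ?_ ?_ ?_ ?_
    · rintro t ht ⟨q, b⟩ hz
      obtain ⟨hq, hb⟩ := Finset.mem_product.1 hz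
      exact ((hwp q hq b hb).2.2 t ht).1.add (((hm t ht).sub_const _).const_mul (q : ℝ))
    · rintro ⟨q, b⟩ hz
      obtain ⟨hq, hb⟩ := Finset.mem_product.1 hz
      simp [U, n, (hwp q hq b hb).2.1]
    · rintro t ht ⟨q, b⟩ hz hmax
      obtain ⟨hq, hb⟩ := Finset.mem_product.1 hz
      rw [hU']
      have hn1 := abs_le.1 (hn t ht)
      have hq' := (M.mem_gridQm).1 hq
      have hb' := (M.mem_gridB).1 hb
      -- Neighbouring inventories differ by one, so `U` and `w` have differences that differ by `±n
      -- t`, at most `c` in absolute value. For neighbouring signals the correction is the same and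
      -- disappears.
      have hd1 : q < M.qmMax → -c ≤ χ t q b - χ t (q + 1) b := fun h => by
        have h1 : U t (q + 1, b) ≤ U t (q, b) := hmax _ (Finset.mk_mem_product
          (M.mem_gridQm.2 ⟨by omega, by omega⟩) hb)
        simp only [U, Int.cast_add, Int.cast_one] at h1
        exact hχ _ _ _ _ _ _ hc (by linarith)
      have hd2 : -M.qmMax < q → -c ≤ χ t q b - χ t (q - 1) b := fun h => by
        have h1 : U t (q - 1, b) ≤ U t (q, b) := hmax _ (Finset.mk_mem_product
          (M.mem_gridQm.2 ⟨by omega, by omega⟩) hb)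
        simp only [U, Int.cast_sub, Int.cast_one] at h1
        exact hχ _ _ _ _ _ _ hc (by linarith)
      have hs1 : b < M.bMax → χ t q (b + 1) ≤ χ t q b := fun h => by
        have h1 : U t (q, b + 1) ≤ U t (q, b) := hmax _ (Finset.mk_mem_product hq
          (M.mem_gridB.2 ⟨by omega, by omega⟩))
        simp only [U] at h1
        linarith [hχ t q b q (b + 1) 0 le_rfl (by linarith)]
      have hs2 : -M.bMax < b → χ t q (b - 1) ≤ χ t q b := fun h => by
        have h1 : U t (q, b - 1) ≤ U t (q, b) := hmax _ (Finset.mk_mem_product hq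
          (M.mem_gridB.2 ⟨by omega, by omega⟩))
        simp only [U] at h1
        linarith [hχ t q b q (b - 1) 0 le_rfl (by linarith)]
      have h1 := M.hamTaker_le hK0 (fun x => (hK x).1) hd1 hd2
      have h2 := M.genSignal_nonpos hs1 hs2
      have h3 := (abs_le.1 (hbq q hq b hb)).2
      have h4 : 0 ≤ M.γ * M.σ ^ 2 * (q : ℝ) ^ 2 := by positivity
      have h5 : 0 ≤ M.γ * M.σ ^ 2 * (M.qmMax : ℝ) ^ 2 := by positivity
      simp only [C]
      linarith
    · rintro t ht ⟨q, b⟩ hz hmin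
      obtain ⟨hq, hb⟩ := Finset.mem_product.1 hz
      rw [hU']
      have hn1 := abs_le.1 (hn t ht)
      have hq' := (M.mem_gridQm).1 hq
      have hb' := (M.mem_gridB).1 hb
      have hd1 : q < M.qmMax → χ t q b - χ t (q + 1) b ≤ c := fun h => by
        have h1 : U t (q, b) ≤ U t (q + 1, b) := hmin _ (Finset.mk_mem_product
          (M.mem_gridQm.2 ⟨by omega, by omega⟩) hb)
        simp only [U, Int.cast_add, Int.cast_one] at h1
        linarith [hχ t (q + 1) b q b c hc (by linarith)]
      have hd2 : -M.qmMax < q → χ t q b - χ t (q - 1) b ≤ c := fun h => by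
        have h1 : U t (q, b) ≤ U t (q - 1, b) := hmin _ (Finset.mk_mem_product
          (M.mem_gridQm.2 ⟨by omega, by omega⟩) hb)
        simp only [U, Int.cast_sub, Int.cast_one] at h1
        linarith [hχ t (q - 1) b q b c hc (by linarith)]
      have hs1 : b < M.bMax → χ t q b ≤ χ t q (b + 1) := fun h => by
        have h1 : U t (q, b) ≤ U t (q, b + 1) := hmin _ (Finset.mk_mem_product hq
          (M.mem_gridB.2 ⟨by omega, by omega⟩))
        simp only [U] at h1
        linarith [hχ t q (b + 1) q b 0 le_rfl (by linarith)]
      have hs2 : -M.bMax < b → χ t q b ≤ χ t q (b - 1) := fun h => by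
        have h1 : U t (q, b) ≤ U t (q, b - 1) := hmin _ (Finset.mk_mem_product hq
          (M.mem_gridB.2 ⟨by omega, by omega⟩))
        simp only [U] at h1
        linarith [hχ t q (b - 1) q b 0 le_rfl (by linarith)]
      have h1 := M.le_hamTaker hK0 (fun x => (hK x).2) hd1 hd2
      have h2 := M.genSignal_nonneg hs1 hs2
      have h3 := (abs_le.1 (hbq q hq b hb)).1
      have h4 := hq2 q hq
      simp only [C]
      linarith
  -- On the grid `|w| ≤ |U| + |q n| ≤ R`; off the grid `w` is 0. The truncation is therefore the
  -- identity.
  have hχw : ∀ t ∈ Icc 0 M.T, χ t = w t := fun t ht => by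
    funext q b
    refine clamp_eq_self ?_
    by_cases h : q ∈ M.gridQm ∧ b ∈ M.gridB
    · have h1 := hUb t ht (q, b) (Finset.mk_mem_product h.1 h.2)
      have h2 : |(q : ℝ) * n t| ≤ M.qmMax * c := by
        rw [abs_mul]
        exact mul_le_mul (hqm q h.1) (hn t ht) (abs_nonneg _) hN.le
      have h3 : w t q b = U t (q, b) - q * n t := by simp [U]
      have h4 : C * (M.T - t) ≤ C * M.T := mul_le_mul_of_nonneg_left (by linarith [ht.1]) hC
      rw [h3]
      refine (abs_sub _ _).trans ?_
      simp only [R]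
      linarith
    · rw [hw0 t q b h, abs_zero]; exact hR
  refine ⟨w, p, hw, hp, hpmf, fun q hq b hb => ⟨(hwp q hq b hb).1, (hwp q hq b hb).2.1,
    fun t ht => ?_⟩⟩
  have h1 := (hwp q hq b hb).2.2 t ht
  change HasDerivWithinAt _ (M.takerField fm (χ t) (p t) q b) _ _ ∧
    HasDerivWithinAt _ (-M.fokkerPlanck (takerBid fm (χ t)) (takerAsk fm (χ t)) (p t) q b) _ _ at h1
  rwa [hχw t ht] at h1

end MarketModel
end

noncomputable section

/-! ### The equation of the market-maker, for given behaviour of the market-takers. -/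

namespace MarketModel

variable (M : MarketModel)

/-- Time derivative of the value function of the market-maker, as prescribed by his
Hamilton–Jacobi–Bellman equation, for the impact `I` and the mean quotes `Da`, `Db` of the
market-takers. -/
def makerField (f : ℝ → ℝ) (I Da Db : ℝ) (W : ℤ → ℝ) (q : ℤ) : ℝ :=
  M.φ * M.σ ^ 2 * (q : ℝ) ^ 2 - q * I
    - ((if q < M.qMax then 1 else 0) * M.Lam Da (f (W q - W (q + 1)))
          * gain (f (W q - W (q + 1))) (W q) (W (q + 1))
      + (if -M.qMax < q then 1 else 0) * M.Lam Db (f (W q - W (q - 1)))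
          * gain (f (W q - W (q - 1))) (W q) (W (q - 1)))

lemma continuous_makerField {X : Type*} [TopologicalSpace X] {f : ℝ → ℝ} (hf : Continuous f)
    {I Da Db : X → ℝ} (hI : Continuous I) (hDa : Continuous Da) (hDb : Continuous Db)
    {W : X → ℤ → ℝ} (hW : ∀ q, Continuous fun x => W x q) (q : ℤ) :
    Continuous fun x => M.makerField f (I x) (Da x) (Db x) (W x) q := by
  unfold makerField Lam gain
  fun_prop

/-- The mean quote factors out of the exponential intensity, leaving the expression that
`IsFeedback` controls. -/
lemma Lam_mul_gain (D : ℝ) (f : ℝ → ℝ) (z z' : ℝ) :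
    M.Lam D (f (z - z')) * gain (f (z - z')) z z' = M.Lam D 0 *
      (Real.exp (-(M.k / M.σ) * f (z - z')) * (f (z - z') - (z - z'))) := by
  unfold Lam gain
  rw [mul_add, Real.exp_add, mul_add, Real.exp_add]
  simp only [mul_zero, Real.exp_zero]
  ring

lemma Lam_pos (x y : ℝ) : 0 < M.Lam x y := mul_pos M.A_pos (Real.exp_pos _)

theorem exists_maker_solution {f : ℝ → ℝ} (hf : IsFeedback (M.k / M.σ) f) {I Da Db : ℝ → ℝ}
    (hI : Continuous I) (hDa : Continuous Da) (hDb : Continuous Db) :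
    ∃ W : ℝ → ℤ → ℝ, (∀ q, Continuous fun t => W t q) ∧
      ∀ q ∈ M.gridQ, W M.T q = 0 ∧ ∀ t ∈ Icc 0 M.T,
        HasDerivWithinAt (fun s => W s q) (M.makerField f (I t) (Da t) (Db t) (W t) q)
          (Icc 0 M.T) t := by
  have hφ := M.φ_pos
  have hT := M.T_pos
  have hN : (0 : ℝ) < M.qMax := by exact_mod_cast M.qMax_pos
  -- No correction of `W` is needed, hence the level 0: the impact is now a given function, bounded
  -- on `[0, T]` independently of the truncation of `W`.
  obtain ⟨K, hK0, hK⟩ := hf.bound 0 le_rfl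
  have hbound : ∀ g : ℝ → ℝ, Continuous g → ∃ B, ∀ t ∈ Icc 0 M.T, |g t| ≤ B := fun g hg =>
    isCompact_Icc.exists_bound_of_continuousOn hg.continuousOn
  have hLc : ∀ D : ℝ → ℝ, Continuous D → Continuous fun t => M.Lam (D t) 0 := fun D hD => by
    unfold Lam; fun_prop
  obtain ⟨B, hB⟩ := hbound I hI
  obtain ⟨Ba, hBa⟩ := hbound _ (hLc Da hDa)
  obtain ⟨Bb, hBb⟩ := hbound _ (hLc Db hDb)
  have h0T : (0 : ℝ) ∈ Icc 0 M.T := ⟨le_rfl, hT.le⟩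
  have hB0 : 0 ≤ B := (abs_nonneg _).trans (hB 0 h0T)
  have hBa0 : 0 ≤ Ba := (abs_nonneg _).trans (hBa 0 h0T)
  have hBb0 : 0 ≤ Bb := (abs_nonneg _).trans (hBb 0 h0T)
  set C : ℝ := M.φ * M.σ ^ 2 * (M.qMax : ℝ) ^ 2 + M.qMax * B + (Ba + Bb) * K
  have hC : 0 ≤ C := by positivity
  set R : ℝ := C * M.T
  have hR : 0 ≤ R := by positivity
  obtain ⟨W, hW, hW0, hWT, hWd⟩ := exists_solution_multipoint_box M.gridQ hT.le
    (fun t W q => M.makerField f (I t) (Da t) (Db t) W q)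
    (fun q => M.continuous_makerField hf.continuous (hI.comp continuous_fst)
      (hDa.comp continuous_fst) (hDb.comp continuous_fst)
      (fun q => (continuous_apply q).comp continuous_snd) q)
    (fun _ => -R) (fun _ => R) (fun _ => by simp only; linarith) (fun _ => M.T)
    (fun _ => ⟨hT.le, le_rfl⟩) fun _ => 0
  set χ : ℝ → ℤ → ℝ := fun t q => max (-R) (min R (W t q))
  have hχ : ∀ {t q q'}, W t q' ≤ W t q → 0 ≤ χ t q - χ t q' := fun h => by
    rw [← neg_zero]
    exact clamp_sub_clamp_ge le_rfl (by linarith)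
  have hterm_le : ∀ (P : Prop) [Decidable P] (D b z z' : ℝ), |M.Lam D 0| ≤ b →
      (P → 0 ≤ z - z') →
      (if P then 1 else 0) * M.Lam D (f (z - z')) * gain (f (z - z')) z z' ≤ b * K := by
    intro P _ D b z z' hD hP
    have hb : 0 ≤ b := (abs_nonneg _).trans hD
    rw [mul_assoc, Lam_mul_gain]
    split_ifs with hp
    · rw [one_mul]
      calc _ ≤ M.Lam D 0 * K :=
            mul_le_mul_of_nonneg_left ((hK _).1 (by linarith [hP hp])) (M.Lam_pos _ _).le
        _ ≤ b * K := mul_le_mul_of_nonneg_right ((le_abs_self _).trans hD) hK0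
    · rw [zero_mul]; positivity
  have hle_term : ∀ (P : Prop) [Decidable P] (D b z z' : ℝ), |M.Lam D 0| ≤ b →
      (P → 0 ≤ z' - z) →
      -(b * K) ≤ (if P then 1 else 0) * M.Lam D (f (z - z')) * gain (f (z - z')) z z' := by
    intro P _ D b z z' hD hP
    have hb : 0 ≤ b := (abs_nonneg _).trans hD
    have hbK : 0 ≤ b * K := by positivity
    rw [mul_assoc, Lam_mul_gain]
    split_ifs with hp
    · rw [one_mul]
      calc -(b * K) ≤ -(M.Lam D 0 * K) :=
            neg_le_neg (mul_le_mul_of_nonneg_right ((le_abs_self _).trans hD) hK0)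
        _ = M.Lam D 0 * -K := by ring
        _ ≤ _ := mul_le_mul_of_nonneg_left ((hK _).2 (by linarith [hP hp])) (M.Lam_pos _ _).le
    · rw [zero_mul]; linarith
  have hq : ∀ q ∈ M.gridQ, |(q : ℝ)| ≤ M.qMax := fun q hq => by
    rw [mem_gridQ] at hq
    exact abs_le.2 ⟨by exact_mod_cast hq.1, by exact_mod_cast hq.2⟩
  have hqI : ∀ t ∈ Icc 0 M.T, ∀ q ∈ M.gridQ, |(q : ℝ) * I t| ≤ M.qMax * B := fun t ht q hq' => by
    rw [abs_mul]
    exact mul_le_mul (hq q hq') (hB t ht) (abs_nonneg _) hN.le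
  have hq2 : ∀ q ∈ M.gridQ, M.φ * M.σ ^ 2 * (q : ℝ) ^ 2 ≤ M.φ * M.σ ^ 2 * (M.qMax : ℝ) ^ 2 :=
    fun q hq' => mul_le_mul_of_nonneg_left (sq_le_sq' (abs_le.1 (hq q hq')).1
      (abs_le.1 (hq q hq')).2) (by positivity)
  have hWb : ∀ t ∈ Icc 0 M.T, ∀ q ∈ M.gridQ, |W t q| ≤ C * (M.T - t) := by
    refine abs_le_of_deriv_bounds_at_extrema _ W _ hWd hWT ?_ ?_
    · intro t ht q hq' hmax
      have hqq := M.mem_gridQ.1 hq'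
      have h1 := hterm_le (q < M.qMax) (Da t) Ba (χ t q) (χ t (q + 1)) (hBa t ht) fun h =>
        hχ (hmax _ (M.mem_gridQ.2 ⟨by omega, by omega⟩))
      have h2 := hterm_le (-M.qMax < q) (Db t) Bb (χ t q) (χ t (q - 1)) (hBb t ht) fun h =>
        hχ (hmax _ (M.mem_gridQ.2 ⟨by omega, by omega⟩))
      have h3 := (abs_le.1 (hqI t ht q hq')).2
      have h4 : 0 ≤ M.φ * M.σ ^ 2 * (q : ℝ) ^ 2 := by positivity
      have h5 : 0 ≤ M.φ * M.σ ^ 2 * (M.qMax : ℝ) ^ 2 := by positivity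
      change -C ≤ M.makerField f (I t) (Da t) (Db t) (χ t) q
      simp only [makerField, C]
      linarith
    · intro t ht q hq' hmin
      have hqq := M.mem_gridQ.1 hq'
      have h1 := hle_term (q < M.qMax) (Da t) Ba (χ t q) (χ t (q + 1)) (hBa t ht) fun h =>
        hχ (hmin _ (M.mem_gridQ.2 ⟨by omega, by omega⟩))
      have h2 := hle_term (-M.qMax < q) (Db t) Bb (χ t q) (χ t (q - 1)) (hBb t ht) fun h =>
        hχ (hmin _ (M.mem_gridQ.2 ⟨by omega, by omega⟩))
      have h3 := (abs_le.1 (hqI t ht q hq')).1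
      have h4 := hq2 q hq'
      change M.makerField f (I t) (Da t) (Db t) (χ t) q ≤ C
      simp only [makerField, C]
      linarith
  have hχW : ∀ t ∈ Icc 0 M.T, χ t = W t := fun t ht => by
    funext q
    refine clamp_eq_self ?_
    by_cases h : q ∈ M.gridQ
    · exact (hWb t ht q h).trans (mul_le_mul_of_nonneg_left (by linarith [ht.1]) hC)
    · rw [hW0 t q h, abs_zero]; exact hR
  refine ⟨W, fun q => (continuous_apply q).comp hW, fun q hq' => ⟨hWT q hq', fun t ht => ?_⟩⟩
  have h1 : HasDerivWithinAt (fun s => W s q) (M.makerField f (I t) (Da t) (Db t) (χ t) q)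
    (Icc 0 M.T) t := hWd t ht q hq'
  rwa [hχW t ht] at h1

/-! ### Independence of the market-takers' equations from values beyond the risk limits. -/

section Ghost

variable {M} {w v : ℤ → ℤ → ℝ}

/-- Values at `±(qmMax + 1)` meet a vanishing indicator. They can therefore be prescribed after the
market-takers' system is solved. -/
lemma impact_congr (h : ∀ q ∈ M.gridQm, ∀ b, w q b = v q b) (fm : ℝ → ℝ) (π : ℤ → ℤ → ℝ) :
    M.impact (takerBid fm w) (takerAsk fm w) π = M.impact (takerBid fm v) (takerAsk fm v) π := by
  unfold impact integ
  congr 1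
  refine Finset.sum_congr rfl fun q hq => Finset.sum_congr rfl fun b _ => ?_
  congr 1
  have hq' := M.mem_gridQm.1 hq
  simp only [netRate, takerBid, takerAsk]
  rw [h q hq]
  congr 1
  · split_ifs with hlt
    · rw [h (q + 1) (M.mem_gridQm.2 ⟨by omega, by omega⟩)]
    · simp
  · split_ifs with hlt
    · rw [h (q - 1) (M.mem_gridQm.2 ⟨by omega, by omega⟩)]
    · simp

lemma takerField_congr (h : ∀ q ∈ M.gridQm, ∀ b, w q b = v q b) (fm : ℝ → ℝ) (π : ℤ → ℤ → ℝ)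
    {q : ℤ} (hq : q ∈ M.gridQm) (b : ℤ) : M.takerField fm w π q b = M.takerField fm v π q b := by
  have hq' := M.mem_gridQm.1 hq
  unfold takerField hamTaker
  rw [impact_congr h, h q hq, h q hq, h q hq]
  congr 2
  · split_ifs with hlt
    · rw [h (q + 1) (M.mem_gridQm.2 ⟨by omega, by omega⟩)]
    · simp
  · split_ifs with hlt
    · rw [h (q - 1) (M.mem_gridQm.2 ⟨by omega, by omega⟩)]
    · simp

lemma fokkerPlanck_congr (h : ∀ q ∈ M.gridQm, ∀ b, w q b = v q b) (fm : ℝ → ℝ)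
    (π : ℤ → ℤ → ℝ) {q : ℤ} (hq : q ∈ M.gridQm) (b : ℤ) :
    M.fokkerPlanck (takerBid fm w) (takerAsk fm w) π q b =
      M.fokkerPlanck (takerBid fm v) (takerAsk fm v) π q b := by
  have hq' := M.mem_gridQm.1 hq
  unfold fokkerPlanck takerBid takerAsk
  rw [sub_add_cancel, add_sub_cancel_right, h q hq]
  have e1 : -M.qmMax < q → w (q - 1) b = v (q - 1) b := fun _ =>
    h _ (M.mem_gridQm.2 ⟨by omega, by omega⟩) b
  have e2 : q < M.qmMax → w (q + 1) b = v (q + 1) b := fun _ =>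
    h _ (M.mem_gridQm.2 ⟨by omega, by omega⟩) b
  by_cases h1 : -M.qmMax < q <;> by_cases h2 : q < M.qmMax <;> simp [h1, h2, e1, e2]

end Ghost

/-! ### Assembly of the solution of the master equation. -/

lemma makerField_eq (f : ℝ → ℝ) (δb δa π : ℤ → ℤ → ℝ) (W : ℤ → ℝ) (q : ℤ) :
    M.makerField f (M.impact δb δa π) (M.integ δa π) (M.integ δb π) W q =
      M.φ * M.σ ^ 2 * (q : ℝ) ^ 2 - q * M.impact δb δa π
        - M.hamMaker q (f (W q - W (q + 1))) (f (W q - W (q - 1))) (W q) (W (q + 1)) (W (q - 1))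
          δb δa π := rfl

/-- Existence of a solution of the master equation for all feedback maps that satisfy
`IsFeedback`. -/
theorem exists_isMasterSolution {f fm : ℝ → ℝ} (hf : IsFeedback (M.k / M.σ) f)
    (hfm : IsFeedback (M.km / M.σ) fm) {P₀ : ℤ → ℤ → ℝ} (hP₀ : M.IsPMF P₀)
    {ePlus eMinus : ℝ → ℤ → ℝ → ℝ}
    (hePlus : ∀ b ∈ M.gridB,
      ContinuousOn (fun x : ℝ × ℝ => ePlus x.1 b x.2) (Icc 0 M.T ×ˢ univ))
    (heMinus : ∀ b ∈ M.gridB,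
      ContinuousOn (fun x : ℝ × ℝ => eMinus x.1 b x.2) (Icc 0 M.T ×ˢ univ)) :
    ∃ (W : ℝ → ℤ → ℝ) (Wm p : ℝ → ℤ → ℤ → ℝ),
      M.IsMasterSolution f fm ePlus eMinus P₀ W Wm p := by
  have hT := M.T_pos
  have hN := M.qmMax_pos
  obtain ⟨w, p, hw, hp, hpmf, hwp⟩ := M.exists_taker_solution hfm hP₀
  -- The functions `ePlus` and `eMinus` are continuous only for times in `[0, T]`; projecting the
  -- time makes the ghost values continuous on the whole line.
  let τ : ℝ → ℝ := fun t => projIcc 0 M.T hT.le t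
  have hτc : Continuous τ := continuous_subtype_val.comp continuous_projIcc
  have hτ : ∀ t ∈ Icc 0 M.T, τ t = t := fun t ht => by simp only [τ, projIcc_of_mem hT.le ht]
  -- Only the two ghost rows are overwritten; they influence the market-maker through the mean
  -- quotes alone.
  let Wm : ℝ → ℤ → ℤ → ℝ := fun t q b =>
    if b ∈ M.gridB ∧ q = M.qmMax + 1 then ePlus (τ t) b (w t M.qmMax b)
    else if b ∈ M.gridB ∧ q = -M.qmMax - 1 then eMinus (τ t) b (w t (-M.qmMax) b) else w t q b
  have hghost : ∀ (e : ℝ → ℤ → ℝ → ℝ) (b q : ℤ),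
      ContinuousOn (fun x : ℝ × ℝ => e x.1 b x.2) (Icc 0 M.T ×ˢ univ) →
      Continuous fun t => e (τ t) b (w t q b) := fun e b q he =>
    he.comp_continuous (hτc.prodMk (hw q b)) fun t => ⟨(projIcc 0 M.T hT.le t).2, mem_univ _⟩
  have hWmc : ∀ q b, Continuous fun t => Wm t q b := fun q b => by
    by_cases h1 : b ∈ M.gridB ∧ q = M.qmMax + 1
    · simpa only [Wm, if_pos h1] using hghost _ _ _ (hePlus b h1.1)
    · by_cases h2 : b ∈ M.gridB ∧ q = -M.qmMax - 1
      · simpa only [Wm, if_neg h1, if_pos h2] using hghost _ _ _ (heMinus b h2.1)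
      · simpa only [Wm, if_neg h1, if_neg h2] using hw q b
  have hWmw : ∀ t, ∀ q ∈ M.gridQm, ∀ b, Wm t q b = w t q b := fun t q hq b => by
    have hq' := M.mem_gridQm.1 hq
    simp only [Wm]
    rw [if_neg fun h => by omega, if_neg fun h => by omega]
  have hmax : M.qmMax ∈ M.gridQm := M.mem_gridQm.2 ⟨by omega, le_rfl⟩
  have hmin : -M.qmMax ∈ M.gridQm := M.mem_gridQm.2 ⟨le_rfl, by omega⟩
  have hWmd : ∀ q ∈ M.gridQm, ∀ b ∈ M.gridB, ∀ t ∈ Icc 0 M.T,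
      HasDerivWithinAt (fun s => Wm s q b) (M.takerField fm (Wm t) (p t) q b) (Icc 0 M.T) t :=
    fun q hq b hb t ht => by
      rw [takerField_congr (hWmw t) fm (p t) hq b]
      simp only [hWmw _ q hq b]
      exact ((hwp q hq b hb).2.2 t ht).1
  have hpd : ∀ q ∈ M.gridQm, ∀ b ∈ M.gridB, ∀ t ∈ Icc 0 M.T, HasDerivWithinAt (fun s => p s q b)
      (-M.fokkerPlanck (takerBid fm (Wm t)) (takerAsk fm (Wm t)) (p t) q b) (Icc 0 M.T) t :=
    fun q hq b hb t ht => by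
      rw [fokkerPlanck_congr (hWmw t) fm (p t) hq b]
      exact ((hwp q hq b hb).2.2 t ht).2
  have hIc := continuous_impact (M := M) hfm.continuous hWmc hp
  have hDa : Continuous fun t => M.integ (takerAsk fm (Wm t)) (p t) := by
    have hfmc := hfm.continuous
    unfold integ takerAsk
    fun_prop
  have hDb : Continuous fun t => M.integ (takerBid fm (Wm t)) (p t) := by
    have hfmc := hfm.continuous
    unfold integ takerBid
    fun_prop
  obtain ⟨W, hW, hWd⟩ := M.exists_maker_solution hf hIc hDa hDb
  have hu := uniqueDiffOn_Icc hT
  refine ⟨W, Wm, p, ?_, ?_, ?_, ?_, ?_, ?_, hpmf, ?_, ?_, ?_, ?_, ?_, fun q hq b hb =>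
    (hwp q hq b hb).1, fun q hq => (hWd q hq).1, fun q hq b hb => ?_⟩
  · exact fun q hq => contDiffOn_one_of_hasDerivWithinAt_Icc hT (hWd q hq).2
      (M.continuous_makerField hf.continuous hIc hDa hDb hW q).continuousOn
  · exact fun q hq b hb => contDiffOn_one_of_hasDerivWithinAt_Icc hT (hWmd q hq b hb)
      (continuous_takerField hfm.continuous hWmc hp q b).continuousOn
  · exact fun q hq b hb => contDiffOn_one_of_hasDerivWithinAt_Icc hT (hpd q hq b hb)
      (continuous_fokkerPlanck hfm.continuous hWmc hp q b).neg.continuousOn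
  · exact exists_bound_of_continuous _ W fun q _ => hW q
  · obtain ⟨C, hC⟩ := exists_bound_of_continuous (T := M.T) (M.gridQm ×ˢ M.gridB)
      (fun t z => Wm t z.1 z.2) fun z _ => hWmc z.1 z.2
    exact ⟨C, fun t ht q hq b hb => hC t ht (q, b) (Finset.mk_mem_product hq hb)⟩
  · exact ⟨1, fun t ht q hq b hb => by
      rw [abs_of_nonneg ((hpmf t ht).1 q hq b hb)]
      exact (hpmf t ht).le_one hq hb⟩
  · intro t ht b hb
    rw [hWmw t _ hmax b]
    simp only [Wm]
    rw [if_pos ⟨hb, trivial⟩, hτ t ht]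
  · intro t ht b hb
    rw [hWmw t _ hmin b]
    simp only [Wm]
    rw [if_neg fun h => by omega, if_pos ⟨hb, trivial⟩, hτ t ht]
  · intro t ht q hq
    rw [((hWd q hq).2 t ht).derivWithin (hu t ht), makerField_eq]
    ring
  · intro t ht q hq b hb
    rw [(hWmd q hq b hb t ht).derivWithin (hu t ht), takerField]
    ring
  · intro t ht q hq b hb
    rw [(hpd q hq b hb t ht).derivWithin (hu t ht), neg_add_cancel]
  · rw [hWmw _ q hq b]
    exact (hwp q hq b hb).2.1

end MarketModel

end

theorem mainTheorem1 (M : MarketModel) (P₀ : ℤ → ℤ → ℝ) (hP₀ : M.IsPMF P₀)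
    (ePlus eMinus : ℝ → ℤ → ℝ → ℝ)
    (hePlus : ∀ b ∈ M.gridB,
      ContinuousOn (fun x : ℝ × ℝ => ePlus x.1 b x.2) (Set.Icc 0 M.T ×ˢ Set.univ))
    (heMinus : ∀ b ∈ M.gridB,
      ContinuousOn (fun x : ℝ × ℝ => eMinus x.1 b x.2) (Set.Icc 0 M.T ×ˢ Set.univ)) :
    (∃ (W : ℝ → ℤ → ℝ) (Wm p : ℝ → ℤ → ℤ → ℝ),
      M.IsMasterSolution M.dbar M.dmbar ePlus eMinus P₀ W Wm p) ∧
    (∀ δinf : ℝ, 0 < δinf → ∃ (W : ℝ → ℤ → ℝ) (Wm p : ℝ → ℤ → ℤ → ℝ),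
      M.IsMasterSolution (fun x => MarketModel.clamp δinf (M.dbar x))
        (fun x => MarketModel.clamp δinf (M.dmbar x)) ePlus eMinus P₀ W Wm p) := by
  have hk : 0 < M.k / M.σ := div_pos M.k_pos M.σ_pos
  have hkm : 0 < M.km / M.σ := div_pos M.km_pos M.σ_pos
  refine ⟨M.exists_isMasterSolution (isFeedback_add hk (div_pos M.σ_pos M.k_pos))
    (isFeedback_add hkm (div_pos M.σ_pos M.km_pos)) hP₀ hePlus heMinus, fun δinf hδ => ?_⟩
  exact M.exists_isMasterSolution
    (isFeedback_clamp hk hδ (continuous_const.add continuous_id))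
    (isFeedback_clamp hkm hδ (continuous_const.add continuous_id)) hP₀ hePlus heMinus
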